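/- Let $\mathcal H=\bigoplus_{n\ge 0}\mathcal H_n$ be a connected graded Hopf algebra over $\mathbb C$ (so $\dim\mathcal H_0=1$, and product, coproduct and antipode respect the grading), with counit $\varepsilon$. Let $Y:\mathcal H\to\mathcal H$ be the linear map with $Y(x)=nx$ for $x\in\mathcal H_n$. Let $\mathcal A$ be the algebra of germs at $0\in\mathbb C$ of meromorphic functions, with the minimal subtraction splitting $\mathcal A=\mathcal A_-\oplus\mathcal A_+$, where $\mathcal A_+$ is the algebra of germs of holomorphic functions and $\mathcal A_-=z^{-1}\mathbb C[z^{-1}]$. Let $*$ be the convolution product on the space $\mathcal L(\mathcal H,\mathcal A)$ of linear maps, with unit $e=1_{\mathcal A}\,\varepsilon$. Let $G=\{\varphi\in\mathcal L(\mathcal H,\mathcal A):\varphi(\mathbf 1)=1\}$, which is a group under $*$, and $\mathfrak g=\{\alpha\in\mathcal L(\mathcal H,\mathcal A):\alpha(\mathbf 1)=0\}$. For $\varphi\in G$ let $\widetilde R(\varphi)\in\mathfrak g$ be the unique element with $$\varphi\circ Y=\varphi*\widetilde R(\varphi),\qquad\text{i.e. } \widetilde R(\varphi)=\varphi^{*-1}*(\varphi\circ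 Y).$$ Let $G_1$ be the set of characters (unital algebra morphisms $\mathcal H\to\mathcal A$), $G_2$ the set of $\varphi\in G$ with $\varphi(xy)=\varphi(yx)$ for all $x,y$; let $\mathfrak g_1$ be the set of derivations ($\alpha(xy)=e(x)\alpha(y)+\alpha(x)e(y)$ for all $x,y$), and $\mathfrak g_2$ the set of $\alpha\in\mathfrak g$ with $\alpha(xy)=\alpha(yx)$ for all $x,y$. The Birkhoff decomposition of $\varphi\in G$ is $\varphi=\varphi_-^{*-1}*\varphi_+$ with $\varphi_-(\mathbf 1)=1$, $\varphi_-(\operatorname{Ker}\varepsilon)\subset\mathcal A_-$ and $\varphi_+(\mathcal H)\subset\mathcal A_+$. For $\psi\in G$ and $t\in\mathbb C$ let $\psi^t\in G$ be given by $\psi^t(x)(z)=e^{tzn}\psi(x)(z)$ for $x\in\mathcal H_n$. Let $G^\Phi$ be the set of $\psi\in G$ such that $(\psi^t)_-$ does not depend on $t$, and let $G^\Phi_-$ be the set of $\psi\in G^\Phi$ with $\psi(\operatorname{Ker}\varepsilon)\subset\mathcal A_-$. Put $G^\Phi_{i,-}=G^\Phi_-\cap G_i$ for $i=1,2$. Let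 $\mathfrak g^c=\{\beta\in\mathcal L(\mathcal H,\mathbb C):\beta(\mathbf 1)=0\}$, viewed inside $\mathfrak g$ through the constants $\mathbb C\subset\mathcal A$, and $\mathfrak g^c_i=\mathfrak g^c\cap\mathfrak g_i$ for $i=1,2$. For $\psi\in\mathcal L(\mathcal H,\mathcal A)$ let $\operatorname{Res}\psi:\mathcal H\to\mathbb C$ send $x$ to the coefficient of $z^{-1}$ in the Laurent expansion of $\psi(x)$ at $0$. **Theorem.** The map $G\to\mathfrak g$, $\psi\mapsto z\widetilde R(\psi)$, restricts to bijections $$G^\Phi_-\to\mathfrak g^c,\qquad G^\Phi_{1,-}\to\mathfrak g^c_1,\qquad G^\Phi_{2,-}\to\mathfrak g^c_2,$$ and for every $\psi\in G^\Phi_-$ $$\widetilde R(\psi)=\frac1z\bigl((\operatorname{Res}\psi)\circ Y\bigr).$$ -/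

import Mathlib

open scoped TensorProduct Topology
open Filter

noncomputable section

namespace HopfRenorm

/-! ### Connected graded Hopf algebras -/

section Graded

variable {H : Type*} [Ring H] [HopfAlgebra ℂ H]

/-- `H = ⨁ 𝓗 n` is a connected graded Hopf algebra. That the `𝓗 n` decompose `H` and that
`𝓗 p * 𝓗 q ⊆ 𝓗 (p + q)` is part of `GradedAlgebra 𝓗`. -/
structure IsConnectedGradedHopf (𝓗 : ℕ → Submodule ℂ H) [GradedAlgebra 𝓗] : Prop where
  comul_mem : ∀ n, ∀ x ∈ 𝓗 n, Coalgebra.comul (R := ℂ) x ∈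
    ⨆ p ∈ Finset.HasAntidiagonal.antidiagonal n,
      LinearMap.range (TensorProduct.map (𝓗 p.1).subtype (𝓗 p.2).subtype)
  antipode_mem : ∀ n, ∀ x ∈ 𝓗 n, HopfAlgebra.antipode ℂ x ∈ 𝓗 n
  connected : Module.finrank ℂ (𝓗 0) = 1

/-- The linear map which is `f n` on the homogeneous component `𝓗 n`. -/
def gradedLift {A : Type*} [AddCommGroup A] [Module ℂ A] (𝓗 : ℕ → Submodule ℂ H)
    [GradedAlgebra 𝓗] (f : ∀ n, 𝓗 n →ₗ[ℂ] A) : H →ₗ[ℂ] A :=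
  DirectSum.toModule ℂ ℕ A f ∘ₗ (DirectSum.decomposeLinearEquiv 𝓗).toLinearMap

theorem gradedLift_of_mem {A : Type*} [AddCommGroup A] [Module ℂ A] (𝓗 : ℕ → Submodule ℂ H)
    [GradedAlgebra 𝓗] (f : ∀ n, 𝓗 n →ₗ[ℂ] A) {n : ℕ} {x : H} (hx : x ∈ 𝓗 n) :
    gradedLift 𝓗 f x = f n ⟨x, hx⟩ := by
  simp only [gradedLift, LinearMap.comp_apply, LinearEquiv.coe_coe,
    DirectSum.decomposeLinearEquiv_apply, DirectSum.decompose_of_mem 𝓗 hx]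
  exact DirectSum.toModule_lof ℂ n _

/-- The biderivation `Y`: multiplication by `n` on `𝓗 n`. -/
def Y (𝓗 : ℕ → Submodule ℂ H) [GradedAlgebra 𝓗] : H →ₗ[ℂ] H :=
  gradedLift 𝓗 fun n => (n : ℂ) • (𝓗 n).subtype

theorem Y_of_mem (𝓗 : ℕ → Submodule ℂ H) [GradedAlgebra 𝓗] {n : ℕ} {x : H} (hx : x ∈ 𝓗 n) :
    Y 𝓗 x = (n : ℂ) • x := by
  simp [Y, gradedLift_of_mem 𝓗 _ hx]

end Graded

/-! ### The convolution algebra, the groups `G`, `G₁`, `G₂` and the Lie algebras `𝔤`, `𝔤₁`, `𝔤₂`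

`WithConv (H →ₗ[ℂ] A)` is the space of linear maps from `H` to `A` with the convolution product
`φ * ψ = m_A ∘ (φ ⊗ ψ) ∘ Δ`, whose unit `1` is `e = u_A ∘ ε`. -/

section Convolution

variable (H A : Type*) [Ring H] [HopfAlgebra ℂ H] [CommRing A] [Algebra ℂ A]

/-- The group `G` of linear maps sending `1` to `1`. -/
def G : Set (WithConv (H →ₗ[ℂ] A)) := {φ | φ 1 = 1}

/-- The characters. -/
def G₁ : Set (WithConv (H →ₗ[ℂ] A)) := {φ | φ 1 = 1 ∧ ∀ x y, φ (x * y) = φ x * φ y}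

/-- The cocycles sending `1` to `1`. -/
def G₂ : Set (WithConv (H →ₗ[ℂ] A)) := {φ | φ 1 = 1 ∧ ∀ x y, φ (x * y) = φ (y * x)}

/-- The Lie algebra `𝔤` of linear maps sending `1` to `0`. -/
def g : Set (WithConv (H →ₗ[ℂ] A)) := {α | α 1 = 0}

/-- The derivations (infinitesimal characters): `α(xy) = e(x)α(y) + α(x)e(y)`. -/
def g₁ : Set (WithConv (H →ₗ[ℂ] A)) :=
  {α | ∀ x y, α (x * y) =
    (1 : WithConv (H →ₗ[ℂ] A)) x * α y + α x * (1 : WithConv (H →ₗ[ℂ] A)) y}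

/-- The cocycles sending `1` to `0`. -/
def g₂ : Set (WithConv (H →ₗ[ℂ] A)) := {α | α 1 = 0 ∧ ∀ x y, α (x * y) = α (y * x)}

/-- The elements of `𝔤` with values in the constants `ℂ ⊆ A`. -/
def gc : Set (WithConv (H →ₗ[ℂ] A)) :=
  {α | ∃ β : H →ₗ[ℂ] ℂ, β 1 = 0 ∧ ∀ x, α x = algebraMap ℂ A (β x)}

variable {H A}

/-- Pointwise multiplication `(f ψ)(x) = f · ψ(x)` by an element `f` of `A`. -/
def mulBy (f : A) (ψ : WithConv (H →ₗ[ℂ] A)) : WithConv (H →ₗ[ℂ] A) :=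
  WithConv.toConv (LinearMap.mulLeft ℂ f ∘ₗ ψ.ofConv)

/-- `φ ∘ Y`. -/
def compY (𝓗 : ℕ → Submodule ℂ H) [GradedAlgebra 𝓗] (φ : WithConv (H →ₗ[ℂ] A)) :
    WithConv (H →ₗ[ℂ] A) :=
  WithConv.toConv (φ.ofConv ∘ₗ Y 𝓗)

/-- The renormalization map `R̃(φ) = φ^{*-1} * (φ ∘ Y)`, that is, the solution `γ` of
`φ ∘ Y = φ * γ`; see `mem_g_and_compY_eq_iff`. `Ring.inverse φ` is the inverse of `φ` for the
convolution product, which exists for `φ ∈ G` by `isUnit_of_mem_G`. -/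
def renormMap (𝓗 : ℕ → Submodule ℂ H) [GradedAlgebra 𝓗] (φ : WithConv (H →ₗ[ℂ] A)) :
    WithConv (H →ₗ[ℂ] A) :=
  Ring.inverse φ * compY 𝓗 φ

/-! #### `G` consists of convolution-invertible elements -/

section Inverse

variable {𝓗 : ℕ → Submodule ℂ H} [GradedAlgebra 𝓗]

/-- `α` vanishes in degrees `< p`. -/
def VanishesBelow (𝓗 : ℕ → Submodule ℂ H) (p : ℕ) (α : WithConv (H →ₗ[ℂ] A)) : Prop :=
  ∀ n < p, ∀ x ∈ 𝓗 n, α x = 0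

theorem VanishesBelow.mul (h𝓗 : IsConnectedGradedHopf 𝓗) {p q : ℕ}
    {α β : WithConv (H →ₗ[ℂ] A)} (hα : VanishesBelow 𝓗 p α) (hβ : VanishesBelow 𝓗 q β) :
    VanishesBelow 𝓗 (p + q) (α * β) := by
  intro n hn x hx
  have key : (⨆ p ∈ Finset.HasAntidiagonal.antidiagonal n,
      LinearMap.range (TensorProduct.map (𝓗 p.1).subtype (𝓗 p.2).subtype)) ≤
      LinearMap.ker (LinearMap.mul' ℂ A ∘ₗ TensorProduct.map α.ofConv β.ofConv) := by
    refine iSup₂_le fun ij hij => ?_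
    rintro _ ⟨u, rfl⟩
    rw [LinearMap.mem_ker]
    induction u with
    | zero => simp
    | add a b ha hb => rw [map_add, map_add, ha, hb, add_zero]
    | tmul a b =>
      have hs : ij.1 + ij.2 = n := by simpa using hij
      have : ij.1 < p ∨ ij.2 < q := by omega
      rcases this with h | h
      · have := hα _ h a a.2
        simp [this]
      · have := hβ _ h b b.2
        simp [this]
  have := key (h𝓗.comul_mem n x hx)
  simpa using this

theorem VanishesBelow.one_of_mem_g (h𝓗 : IsConnectedGradedHopf 𝓗)
    {α : WithConv (H →ₗ[ℂ] A)} (hα : α ∈ g H A) : VanishesBelow 𝓗 1 α := by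
  intro n hn x hx
  obtain rfl : n = 0 := by omega
  have h1 : (1 : H) ∈ 𝓗 0 := SetLike.GradedOne.one_mem
  have hne : (1 : H) ≠ 0 := by
    intro h
    have := congrArg (Coalgebra.counit (R := ℂ)) h
    simp at this
  have hv : (⟨1, h1⟩ : 𝓗 0) ≠ 0 := by
    intro h
    exact hne (congrArg Subtype.val h)
  obtain ⟨c, hc⟩ := (finrank_eq_one_iff_of_nonzero' _ hv).1 h𝓗.connected ⟨x, hx⟩
  have hx' : x = c • (1 : H) := by simpa using (congrArg Subtype.val hc).symm
  have h0 : α.ofConv 1 = 0 := hα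
  rw [hx', map_smul, h0, smul_zero]

theorem VanishesBelow.pow (h𝓗 : IsConnectedGradedHopf 𝓗)
    {α : WithConv (H →ₗ[ℂ] A)} (hα : α ∈ g H A) (n : ℕ) : VanishesBelow 𝓗 n (α ^ n) := by
  induction n with
  | zero => intro n hn; omega
  | succ n ih => rw [pow_succ]; exact ih.mul h𝓗 (VanishesBelow.one_of_mem_g h𝓗 hα)


/-- Elements of `G` are invertible for the convolution product. -/
theorem isUnit_of_mem_G (h𝓗 : IsConnectedGradedHopf 𝓗) {φ : WithConv (H →ₗ[ℂ] A)}
    (hφ : φ ∈ G H A) : IsUnit φ := by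
  have hG : φ.ofConv 1 = 1 := hφ
  set α : WithConv (H →ₗ[ℂ] A) := 1 - φ with hα
  have hαg : α ∈ g H A := by
    change (1 - φ : WithConv (H →ₗ[ℂ] A)).ofConv 1 = 0
    rw [WithConv.ofConv_sub, LinearMap.sub_apply, hG, LinearMap.convOne_apply]
    simp
  let S : ℕ → WithConv (H →ₗ[ℂ] A) := fun N => ∑ k ∈ Finset.range N, α ^ k
  let s : WithConv (H →ₗ[ℂ] A) :=
    WithConv.toConv (gradedLift 𝓗 fun n => (S (n + 1)).ofConv ∘ₗ (𝓗 n).subtype)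
  have hs : ∀ N, VanishesBelow 𝓗 N (s - S N) := by
    intro N n hn x hx
    have h1 : s.ofConv x = (S (n + 1)).ofConv x := by
      change gradedLift 𝓗 _ x = _
      rw [gradedLift_of_mem 𝓗 _ hx]
      rfl
    have h2 : ∀ M, n + 1 ≤ M → (S M).ofConv x = (S (n + 1)).ofConv x := by
      intro M hM
      induction M, hM using Nat.le_induction with
      | base => rfl
      | succ M hM ih =>
        have : S (M + 1) = S M + α ^ M := Finset.sum_range_succ _ _
        rw [this, WithConv.ofConv_add, LinearMap.add_apply, ih,
          VanishesBelow.pow h𝓗 hαg M n (by omega) x hx, add_zero]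
    rw [WithConv.ofConv_sub, LinearMap.sub_apply, h1, h2 N (by omega), sub_self]
  have ext0 : ∀ β : WithConv (H →ₗ[ℂ] A), (∀ N, VanishesBelow 𝓗 N β) → β = 0 := by
    intro β hβ
    ext x
    induction x using DirectSum.Decomposition.inductionOn 𝓗 with
    | zero => simp
    | @homogeneous n m => simpa using hβ (n + 1) n (by omega) m m.2
    | add a b ha hb => rw [map_add, ha, hb]; simp
  have vadd : ∀ N (a b : WithConv (H →ₗ[ℂ] A)), VanishesBelow 𝓗 N a → VanishesBelow 𝓗 N b →
      VanishesBelow 𝓗 N (a - b) := by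
    intro N a b ha hb n hn x hx
    rw [WithConv.ofConv_sub, LinearMap.sub_apply, ha n hn x hx, hb n hn x hx, sub_self]
  have v0 : ∀ a : WithConv (H →ₗ[ℂ] A), VanishesBelow 𝓗 0 a := fun a n hn => by omega
  have hφα : φ = 1 - α := by rw [hα]; abel
  have r : φ * s = 1 := by
    refine sub_eq_zero.1 (ext0 _ fun N => ?_)
    have e : φ * s - 1 = φ * (s - S N) - α ^ N := by
      have := mul_neg_geom_sum α N
      rw [← hφα] at this
      change φ * s - 1 = φ * (s - ∑ k ∈ Finset.range N, α ^ k) - α ^ N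
      rw [mul_sub, this]; abel
    rw [e]
    refine vadd _ _ _ ?_ (VanishesBelow.pow h𝓗 hαg N)
    simpa using (v0 φ).mul h𝓗 (hs N)
  have l : s * φ = 1 := by
    refine sub_eq_zero.1 (ext0 _ fun N => ?_)
    have e : s * φ - 1 = (s - S N) * φ - α ^ N := by
      have := geom_sum_mul_neg α N
      rw [← hφα] at this
      change s * φ - 1 = (s - ∑ k ∈ Finset.range N, α ^ k) * φ - α ^ N
      rw [sub_mul, this]; abel
    rw [e]
    refine vadd _ _ _ ?_ (VanishesBelow.pow h𝓗 hαg N)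
    simpa using (hs N).mul h𝓗 (v0 φ)
  exact ⟨⟨φ, s, r, l⟩, rfl⟩

/-- For `φ ∈ G`, the equation `φ ∘ Y = φ * γ` has exactly one solution `γ ∈ 𝔤`, namely
`γ = R̃(φ)`. -/
theorem mem_g_and_compY_eq_iff (h𝓗 : IsConnectedGradedHopf 𝓗) {φ : WithConv (H →ₗ[ℂ] A)}
    (hφ : φ ∈ G H A) (γ : WithConv (H →ₗ[ℂ] A)) :
    (γ ∈ g H A ∧ compY 𝓗 φ = φ * γ) ↔ γ = renormMap 𝓗 φ := by
  have hu := isUnit_of_mem_G h𝓗 hφ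
  have hG : φ.ofConv 1 = 1 := hφ
  have hiff : compY 𝓗 φ = φ * γ ↔ γ = renormMap 𝓗 φ := by
    constructor
    · intro h
      rw [renormMap, h, ← mul_assoc, Ring.inverse_mul_cancel _ hu, one_mul]
    · rintro rfl
      rw [renormMap, ← mul_assoc, Ring.mul_inverse_cancel _ hu, one_mul]
  refine ⟨fun h => hiff.1 h.2, fun h => ⟨?_, hiff.2 h⟩⟩
  have h1 : (compY 𝓗 φ).ofConv 1 = 0 := by
    have : Y 𝓗 1 = 0 := by
      rw [Y_of_mem 𝓗 (SetLike.GradedOne.one_mem : (1 : H) ∈ 𝓗 0)]; simp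
    change φ.ofConv (Y 𝓗 1) = 0
    rw [this, map_zero]
  rw [hiff.2 h, LinearMap.convMul_apply] at h1
  change γ.ofConv 1 = 0
  simpa [Algebra.TensorProduct.one_def, hG] using h1

end Inverse

end Convolution

/-! ### The algebra of germs at `0` of meromorphic functions -/

section Germs

/-- Germs at `0` of functions on pointed neighbourhoods of `0` form a `ℂ`-algebra. -/
instance germAlgebra : Algebra ℂ (Germ (𝓝[≠] (0 : ℂ)) ℂ) :=
  Algebra.ofModule
    (by rintro c ⟨f⟩ ⟨h⟩; exact congrArg _ (funext fun z => smul_mul_assoc c (f z) (h z)))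
    (by rintro c ⟨f⟩ ⟨h⟩; exact congrArg _ (funext fun z => mul_smul_comm c (f z) (h z)))

theorem germ_algebraMap (c : ℂ) :
    algebraMap ℂ (Germ (𝓝[≠] (0 : ℂ)) ℂ) c = ((fun _ => c : ℂ → ℂ) : Germ (𝓝[≠] (0 : ℂ)) ℂ) := by
  rw [Algebra.algebraMap_eq_smul_one]
  exact congrArg _ (funext fun z => mul_one c)

/-- The algebra `𝒜` of germs at `0` of meromorphic functions. -/
def meroGerms : Subalgebra ℂ (Germ (𝓝[≠] (0 : ℂ)) ℂ) where
  carrier := {a | ∃ f : ℂ → ℂ, MeromorphicAt f 0 ∧ a = f}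
  mul_mem' := by
    rintro _ _ ⟨f, hf, rfl⟩ ⟨h, hh, rfl⟩
    exact ⟨f * h, hf.mul hh, rfl⟩
  add_mem' := by
    rintro _ _ ⟨f, hf, rfl⟩ ⟨h, hh, rfl⟩
    exact ⟨f + h, hf.add hh, rfl⟩
  algebraMap_mem' c := ⟨fun _ => c, MeromorphicAt.const c 0, germ_algebraMap c⟩

/-- The algebra `𝒜` of germs at `0` of meromorphic functions, as a type. -/
abbrev Mero : Type := meroGerms

/-- The germ at `0` of a meromorphic function. -/
def Mero.of (f : ℂ → ℂ) (hf : MeromorphicAt f 0) : Mero := ⟨f, f, hf, rfl⟩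

/-- The germ of `z ↦ z`. -/
def zGerm : Mero := Mero.of (fun z => z) (MeromorphicAt.id 0)

/-- The germ of `z ↦ 1 / z`. -/
def zInvGerm : Mero := Mero.of (fun z => z⁻¹) (MeromorphicAt.id 0).inv

/-- The germ of `z ↦ exp (c z)`. -/
def expGerm (c : ℂ) : Mero :=
  Mero.of (fun z => Complex.exp (c * z)) (by
    apply AnalyticAt.meromorphicAt; fun_prop)

theorem zGerm_mul_zInvGerm : zGerm * zInvGerm = 1 := by
  apply Subtype.ext
  refine Germ.coe_eq.2 ?_
  filter_upwards [self_mem_nhdsWithin] with z hz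
  exact mul_inv_cancel₀ hz

/-- `𝒜₊`: germs of holomorphic functions. -/
def holoGerms : Subalgebra ℂ Mero where
  carrier := {a | ∃ f : ℂ → ℂ, AnalyticAt ℂ f 0 ∧ (a : Germ (𝓝[≠] (0 : ℂ)) ℂ) = f}
  mul_mem' := by
    rintro a b ⟨f, hf, ha⟩ ⟨h, hh, hb⟩
    exact ⟨f * h, hf.mul hh, by rw [MulMemClass.coe_mul, ha, hb]; rfl⟩
  add_mem' := by
    rintro a b ⟨f, hf, ha⟩ ⟨h, hh, hb⟩
    exact ⟨f + h, hf.add hh, by rw [AddMemClass.coe_add, ha, hb]; rfl⟩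
  algebraMap_mem' c := ⟨fun _ => c, analyticAt_const, germ_algebraMap c⟩

/-- `𝒜₋ = z⁻¹ ℂ[z⁻¹]`: germs of polar parts. -/
def polarGerms : NonUnitalSubalgebra ℂ Mero where
  carrier := {a | ∃ p : Polynomial ℂ, (a : Germ (𝓝[≠] (0 : ℂ)) ℂ) =
    ((fun z => z⁻¹ * p.eval z⁻¹ : ℂ → ℂ) : Germ (𝓝[≠] (0 : ℂ)) ℂ)}
  mul_mem' := by
    rintro a b ⟨p, ha⟩ ⟨q, hb⟩
    refine ⟨Polynomial.X * p * q, ?_⟩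
    rw [MulMemClass.coe_mul, ha, hb]
    refine congrArg _ (funext fun z => ?_)
    simp only [Polynomial.eval_mul, Polynomial.eval_X]
    ring
  add_mem' := by
    rintro a b ⟨p, ha⟩ ⟨q, hb⟩
    refine ⟨p + q, ?_⟩
    rw [AddMemClass.coe_add, ha, hb]
    refine congrArg _ (funext fun z => ?_)
    simp only [Polynomial.eval_add]
    ring
  zero_mem' := ⟨0, congrArg _ (funext fun z => by simp)⟩
  smul_mem' := by
    rintro c a ⟨p, ha⟩
    refine ⟨c • p, ?_⟩
    rw [SetLike.val_smul, ha]
    refine congrArg _ (funext fun z => ?_)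
    simp only [Function.comp_apply, Polynomial.eval_smul, smul_eq_mul]
    ring

/-- `c` is the family of coefficients of the Laurent expansion `a(z) = ∑ c n z^n` of the germ `a`,
valid in some pointed neighbourhood of `0`, with finitely many negative powers. -/
def HasLaurentExpansion (a : Mero) (c : ℤ → ℂ) : Prop :=
  (∃ N : ℤ, ∀ n < N, c n = 0) ∧
  ∃ f : ℂ → ℂ, (a : Germ (𝓝[≠] (0 : ℂ)) ℂ) = f ∧
    ∀ᶠ z in 𝓝[≠] (0 : ℂ), HasSum (fun n : ℤ => c n * z ^ n) (f z)

theorem exists_hasLaurentExpansion (a : Mero) : ∃ c, HasLaurentExpansion a c := by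
  obtain ⟨a, f, ⟨n, p, hp⟩, rfl⟩ := a
  have hp' := hasFPowerSeriesAt_iff.1 hp
  let c : ℤ → ℂ := fun m => if 0 ≤ m + n then p.coeff (m + n).toNat else 0
  refine ⟨c, ⟨-n, fun m hm => if_neg (by omega)⟩, f, rfl, ?_⟩
  have hp'' := hp'.filter_mono (nhdsWithin_le_nhds (s := {0}ᶜ))
  filter_upwards [hp'', self_mem_nhdsWithin] with z hz hz0
  have hz0 : z ≠ 0 := hz0
  have inj : Function.Injective (fun k : ℕ => (k : ℤ) - n) := fun a b h => by
    simpa using h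
  rw [← inj.hasSum_iff]
  · have := hz.mul_left (z ^ n)⁻¹
    simp only [zero_add, sub_zero, smul_eq_mul] at this
    rw [inv_mul_cancel_left₀ (pow_ne_zero n hz0)] at this
    refine (congrArg (fun u => HasSum u _) (funext fun k => ?_)).mpr this
    have h1 : (0 : ℤ) ≤ (k : ℤ) - n + n := by omega
    have h2 : ((k : ℤ) - n + n).toNat = k := by omega
    simp only [Function.comp_apply, c, if_pos h1, h2]
    rw [zpow_sub₀ hz0, zpow_natCast, zpow_natCast]
    field_simp
  · intro m hm
    have : ¬ 0 ≤ m + n := fun h => hm ⟨(m + n).toNat, by simp [Int.toNat_of_nonneg h]⟩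
    simp [c, this]

theorem HasLaurentExpansion.unique {a : Mero} {c d : ℤ → ℂ} (hc : HasLaurentExpansion a c)
    (hd : HasLaurentExpansion a d) : c = d := by
  obtain ⟨⟨N, hN⟩, f, haf, hf⟩ := hc
  obtain ⟨⟨M, hM⟩, h, hah, hh⟩ := hd
  have hfh : f =ᶠ[𝓝[≠] (0 : ℂ)] h := Germ.coe_eq.1 (haf.symm.trans hah)
  set K := min N M
  let e : ℕ → ℂ := fun k => c (k + K) - d (k + K)
  let p : FormalMultilinearSeries ℂ ℂ ℂ := FormalMultilinearSeries.ofScalars ℂ e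
  let F : ℂ → ℂ := fun z => if z = 0 then e 0 else 0
  have hp : HasFPowerSeriesAt F p 0 := by
    rw [hasFPowerSeriesAt_iff]
    have key : ∀ᶠ z in 𝓝[≠] (0 : ℂ), HasSum (fun n => z ^ n • p.coeff n) (F (0 + z)) := by
      filter_upwards [hf, hh, hfh, self_mem_nhdsWithin] with z h1 h2 h3 hz0
      have hz0 : z ≠ 0 := hz0
      have h4 := h1.sub h2
      rw [h3, sub_self] at h4
      have inj : Function.Injective (fun k : ℕ => (k : ℤ) + K) := fun a b h => by
        simpa using h
      rw [← inj.hasSum_iff] at h4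
      · have := h4.mul_left (z ^ (-K))
        simp only [zero_add, F, if_neg hz0]
        rw [mul_zero] at this
        refine (congrArg (fun u => HasSum u _) (funext fun k => ?_)).mpr this
        simp only [Function.comp_apply, p, FormalMultilinearSeries.coeff_ofScalars, e, smul_eq_mul]
        rw [← sub_mul, mul_left_comm, ← zpow_add₀ hz0, neg_add_cancel_comm_assoc,
          zpow_natCast, mul_comm]
      · intro m hm
        have : m < K := by
          by_contra hlt
          exact hm ⟨(m - K).toNat, by simp only []; omega⟩
        simp [hN m (by omega), hM m (by omega)]
    rw [eventually_nhdsWithin_iff] at key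
    filter_upwards [key] with z hz
    by_cases h0 : z = 0
    · subst h0
      have := hasSum_single (f := fun n => (0 : ℂ) ^ n • p.coeff n) 0
        (fun n hn => by simp [zero_pow hn])
      simpa [F, p, FormalMultilinearSeries.coeff_ofScalars] using this
    · exact hz h0
  have hF0 : F =ᶠ[𝓝[≠] (0 : ℂ)] fun _ => 0 := by
    filter_upwards [self_mem_nhdsWithin] with z hz
    exact if_neg hz
  have hF : F =ᶠ[𝓝 (0 : ℂ)] fun _ => 0 :=
    (AnalyticAt.frequently_eq_iff_eventually_eq hp.analyticAt analyticAt_const).1 hF0.frequently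
  have hp0 : p = 0 := hp.eq_zero_of_eventually hF
  funext m
  by_cases hm : m < K
  · rw [hN m (by omega), hM m (by omega)]
  · have : p.coeff (m - K).toNat = 0 := by rw [hp0]; rfl
    rw [FormalMultilinearSeries.coeff_ofScalars] at this
    have h1 : ((m - K).toNat : ℤ) + K = m := by omega
    simp only [e, h1] at this
    exact sub_eq_zero.1 this

/-- The coefficient of `z⁻¹` in the Laurent expansion. -/
def residue (a : Mero) : ℂ := (exists_hasLaurentExpansion a).choose (-1)

theorem HasLaurentExpansion.residue_eq {a : Mero} {c : ℤ → ℂ} (hc : HasLaurentExpansion a c) :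
    residue a = c (-1) := by
  rw [residue, (exists_hasLaurentExpansion a).choose_spec.unique hc]

end Germs

/-! ### Birkhoff decomposition for minimal subtraction and the sets `G^Φ`, `G^Φ₋` -/

section Birkhoff

variable {H : Type*} [Ring H] [HopfAlgebra ℂ H]

/-- `φ = m^{*-1} * p` is the Birkhoff decomposition of `φ`, with `φ₋ = m` and `φ₊ = p`. -/
structure IsBirkhoff (φ m p : WithConv (H →ₗ[ℂ] Mero)) : Prop where
  eq : φ = Ring.inverse m * p
  minus_one : m 1 = 1
  minus_mem : ∀ x, Coalgebra.counit (R := ℂ) x = 0 → m x ∈ polarGerms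
  plus_mem : ∀ x, p x ∈ holoGerms

/-- `ψ^t(x)(z) = e^{t z n} ψ(x)(z)` for `x ∈ 𝓗 n`. -/
def twist (𝓗 : ℕ → Submodule ℂ H) [GradedAlgebra 𝓗] (t : ℂ) (ψ : WithConv (H →ₗ[ℂ] Mero)) :
    WithConv (H →ₗ[ℂ] Mero) :=
  WithConv.toConv (gradedLift 𝓗 fun n =>
    LinearMap.mulLeft ℂ (expGerm (t * n)) ∘ₗ ψ.ofConv ∘ₗ (𝓗 n).subtype)

theorem twist_of_mem (𝓗 : ℕ → Submodule ℂ H) [GradedAlgebra 𝓗] (t : ℂ)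
    (ψ : WithConv (H →ₗ[ℂ] Mero)) {n : ℕ} {x : H} (hx : x ∈ 𝓗 n) :
    twist 𝓗 t ψ x = expGerm (t * n) * ψ x := by
  change gradedLift 𝓗 _ x = _
  rw [gradedLift_of_mem 𝓗 _ hx]
  rfl

/-- `G^Φ`: the elements `ψ` of `G` for which the polar part `(ψ^t)₋` of the Birkhoff
decomposition of `ψ^t` is the same for all `t`. -/
def GΦ (𝓗 : ℕ → Submodule ℂ H) [GradedAlgebra 𝓗] : Set (WithConv (H →ₗ[ℂ] Mero)) :=
  {ψ | ψ ∈ G H Mero ∧ ∃ m, ∀ t : ℂ, ∃ p, IsBirkhoff (twist 𝓗 t ψ) m p}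

/-- `G^Φ₋`: the elements of `G^Φ` which send `Ker ε` into `𝒜₋`. -/
def GΦminus (𝓗 : ℕ → Submodule ℂ H) [GradedAlgebra 𝓗] : Set (WithConv (H →ₗ[ℂ] Mero)) :=
  {ψ | ψ ∈ GΦ 𝓗 ∧ ∀ x, Coalgebra.counit (R := ℂ) x = 0 → ψ x ∈ polarGerms}

/-- `Res ψ : H → ℂ`. -/
def Res (ψ : WithConv (H →ₗ[ℂ] Mero)) (x : H) : ℂ := residue (ψ x)

end Birkhoff

end HopfRenorm

end

open HopfRenorm

noncomputable section

namespace HopfRenorm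

/-! ### Graded convolution: reduction to homogeneous elements, inverses, cocycles, characters -/

section Convolution

variable {H A : Type*} [Ring H] [HopfAlgebra ℂ H] [CommRing A] [Algebra ℂ A]
  {𝓗 : ℕ → Submodule ℂ H} [GradedAlgebra 𝓗]

/-! Let `ψ ∈ G` send `Ker ε` into `𝒜₋`. Then `ψ^{*-1}` does so too, and since `𝒜₋ ∩ 𝒜₊ = 0` the only
candidate for a `t`-independent `(ψ^t)₋` is its value at `t = 0`, namely `ψ^{*-1}`. Hence `ψ ∈ G^Φ`
exactly when `ψ^{*-1} * ψ^t` is holomorphic for all `t`. On a fixed `x` this is a finite sum of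
terms `e^{tnz} aₙ` with poles of bounded order, so modulo `𝒜₊` it is a polynomial in `t`, and it is
holomorphic for all `t` exactly when every `h_k = ψ^{*-1} * (zY)^k ψ` is, where `(zY)^k ψ` is
`(nz)^k ψ` in degree `n` (`sum_expGerm_mem_iff`). Now `h_1 = z R̃(ψ)`, and `h_{k+1} = z R̃(ψ) * h_k
+ z (h_k ∘ Y)`, so the single condition that `z R̃(ψ)` be holomorphic suffices (`mem_GΦminus_iff`).

The values of `R̃(ψ)` lie in `𝒜₋`, and `z 𝒜₋ ∩ 𝒜₊ = ℂ`, so `z R̃(ψ)` is constant. In `ψ ∘ Y = R̃(ψ)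
+ (ψ - e) * R̃(ψ)` the last term has values in `z⁻¹ 𝒜₋` and contributes no residue; this gives the
formula for `R̃(ψ)`.

Conversely, for any `γ ∈ 𝔤` the equation `ψ ∘ Y = ψ * γ` has a unique solution in `G`: in degree `n
> 0` the left side is `n ψ`, while the right side, apart from the contribution of the unit, involves
`ψ` only in lower degrees. The solution is the series `expansion`; for `γ = β / z` with `β` constant
all its terms but `e` are polar. Cocycles pass through convolution and the series termwise.
Characters correspond to derivations because the defect of multiplicativity of `ψ` satisfies a
linear equation with only the zero solution (`renormMap_mem_g₁`, `mem_G₁_of_compY_eq_mul`). -/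

theorem conv_ext_of_homogeneous {φ ψ : WithConv (H →ₗ[ℂ] A)}
    (h : ∀ n, ∀ x ∈ 𝓗 n, φ x = ψ x) : φ = ψ := by
  ext x
  induction x using DirectSum.Decomposition.inductionOn 𝓗 with
  | zero => simp
  | @homogeneous n m => exact h n m m.2
  | add a b ha hb => rw [map_add, ha, hb, map_add]

theorem eq_zero_of_vanishesBelow {β : WithConv (H →ₗ[ℂ] A)}
    (hβ : ∀ N, VanishesBelow 𝓗 N β) : β = 0 :=
  conv_ext_of_homogeneous fun n x hx => by simpa using hβ (n + 1) n (by omega) x hx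

theorem forall_mem_of_homogeneous {φ : WithConv (H →ₗ[ℂ] A)} {S : Submodule ℂ A}
    (h : ∀ n, ∀ x ∈ 𝓗 n, φ x ∈ S) (x : H) : φ x ∈ S := by
  induction x using DirectSum.Decomposition.inductionOn 𝓗 with
  | zero => rw [map_zero]; exact S.zero_mem
  | @homogeneous n m => exact h n m m.2
  | add a b ha hb => rw [map_add]; exact S.add_mem ha hb

theorem bilin_eq_zero_of_homogeneous {B : H →ₗ[ℂ] H →ₗ[ℂ] A}
    (h : ∀ p q, ∀ x ∈ 𝓗 p, ∀ y ∈ 𝓗 q, B x y = 0) (x y : H) : B x y = 0 := by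
  induction x using DirectSum.Decomposition.inductionOn 𝓗 with
  | zero => simp
  | add a b ha hb => rw [map_add, LinearMap.add_apply, ha, hb, add_zero]
  | @homogeneous p x =>
    induction y using DirectSum.Decomposition.inductionOn 𝓗 with
    | zero => simp
    | add a b ha hb => rw [map_add, ha, hb, add_zero]
    | @homogeneous q y => exact h p q x x.2 y y.2

/-- Separate submodules for the factors and the product serve polar times polar, holomorphic times
holomorphic, and polar times constant alike. -/
theorem convMul_mem {S T U : Submodule ℂ A} (hm : ∀ s ∈ S, ∀ t ∈ T, s * t ∈ U)
    {α β : WithConv (H →ₗ[ℂ] A)} (hα : ∀ x, α x ∈ S) (hβ : ∀ x, β x ∈ T) (x : H) :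
    (α * β) x ∈ U := by
  rw [(Coalgebra.Repr.arbitrary ℂ x).convMul_apply]
  exact U.sum_mem fun i _ => hm _ (hα _) _ (hβ _)

theorem convMul_apply_mul (α β : WithConv (H →ₗ[ℂ] A)) {x y : H} {ι κ : Type*}
    (r : Coalgebra.Repr ℂ x ι) (s : Coalgebra.Repr ℂ y κ) :
    (α * β) (x * y) = ∑ i ∈ r.index, ∑ j ∈ s.index,
      α (r.left i * s.left j) * β (r.right i * s.right j) := by
  rw [LinearMap.convMul_apply, Bialgebra.comul_mul, ← r.eq, ← s.eq, Finset.sum_mul_sum]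
  simp [map_sum]

theorem convMul_one_right_apply (α β : WithConv (H →ₗ[ℂ] A)) (hα : α 1 = 1) :
    (α * β) 1 = β 1 := by
  rw [LinearMap.convMul_apply]
  simp [Algebra.TensorProduct.one_def, hα]

/-- Since `Δ` respects the grading, a linear map on `H ⊗ H` need only be tested on pure tensors of
bidegree `(p, q)` with `p + q = n`. -/
theorem mul'_map_eq_zero_of_antidiagonal (h𝓗 : IsConnectedGradedHopf 𝓗)
    {L : H ⊗[ℂ] H →ₗ[ℂ] A} {n : ℕ}
    (hL : ∀ p q, p + q = n → ∀ x ∈ 𝓗 p, ∀ y ∈ 𝓗 q, L (x ⊗ₜ y) = 0) {x : H} (hx : x ∈ 𝓗 n) :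
    L (Coalgebra.comul x) = 0 := by
  have key : (⨆ p ∈ Finset.HasAntidiagonal.antidiagonal n,
      LinearMap.range (TensorProduct.map (𝓗 p.1).subtype (𝓗 p.2).subtype)) ≤
      LinearMap.ker L := by
    refine iSup₂_le fun ij hij => ?_
    rintro _ ⟨u, rfl⟩
    rw [LinearMap.mem_ker]
    induction u with
    | zero => simp
    | add a b ha hb => rw [map_add, map_add, ha, hb, add_zero]
    | tmul a b => exact hL _ _ (by simpa using hij) a a.2 b b.2
  exact key (h𝓗.comul_mem n x hx)

/-- `Y` is a coderivation, so `φ ↦ φ ∘ Y` is a derivation of the convolution algebra. -/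
theorem compY_mul (h𝓗 : IsConnectedGradedHopf 𝓗) (φ χ : WithConv (H →ₗ[ℂ] A)) :
    compY 𝓗 (φ * χ) = compY 𝓗 φ * χ + φ * compY 𝓗 χ := by
  refine conv_ext_of_homogeneous (𝓗 := 𝓗) fun n x hx => ?_
  let L : H ⊗[ℂ] H →ₗ[ℂ] A :=
    (n : ℂ) • (LinearMap.mul' ℂ A ∘ₗ TensorProduct.map φ.ofConv χ.ofConv) -
    (LinearMap.mul' ℂ A ∘ₗ TensorProduct.map (compY 𝓗 φ).ofConv χ.ofConv +
      LinearMap.mul' ℂ A ∘ₗ TensorProduct.map φ.ofConv (compY 𝓗 χ).ofConv)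
  have hL : L (Coalgebra.comul x) = 0 := by
    refine mul'_map_eq_zero_of_antidiagonal h𝓗 ?_ hx
    rintro p q rfl x hx y hy
    simp [L, compY, Y_of_mem 𝓗 hx, Y_of_mem 𝓗 hy, add_smul]
  have h1 : compY 𝓗 (φ * χ) x = (n : ℂ) • (φ * χ) x := by
    change (φ * χ).ofConv (Y 𝓗 x) = _
    rw [Y_of_mem 𝓗 hx, map_smul]
  rw [h1]
  exact sub_eq_zero.1 hL

theorem compY_of_mem (φ : WithConv (H →ₗ[ℂ] A)) {n : ℕ} {x : H} (hx : x ∈ 𝓗 n) :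
    compY 𝓗 φ x = (n : ℂ) • φ x := by
  change φ.ofConv (Y 𝓗 x) = _
  rw [Y_of_mem 𝓗 hx, map_smul]

/-- The map which multiplies `φ` by `f n` on `𝓗 n`. -/
def gradedMul (𝓗 : ℕ → Submodule ℂ H) [GradedAlgebra 𝓗] (f : ℕ → A)
    (φ : WithConv (H →ₗ[ℂ] A)) : WithConv (H →ₗ[ℂ] A) :=
  WithConv.toConv (gradedLift 𝓗 fun n => LinearMap.mulLeft ℂ (f n) ∘ₗ φ.ofConv ∘ₗ (𝓗 n).subtype)

theorem gradedMul_of_mem (f : ℕ → A) (φ : WithConv (H →ₗ[ℂ] A)) {n : ℕ} {x : H}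
    (hx : x ∈ 𝓗 n) : gradedMul 𝓗 f φ x = f n * φ x := by
  change gradedLift 𝓗 _ x = _
  rw [gradedLift_of_mem 𝓗 _ hx]
  rfl

/-- The coefficients collect the right-hand factors of `Δ x` by degree and do not depend on `f`. The
same `a` therefore serves for `f n = e^{tnz}` and for `f n = (nz)^k`, which allows expansion in `t`.
-/
theorem exists_convMul_gradedMul_eq_sum (φ ψ : WithConv (H →ₗ[ℂ] A)) (x : H) :
    ∃ a : ℕ →₀ A, ∀ f : ℕ → A, (φ * gradedMul 𝓗 f ψ) x = a.sum fun n u => f n * u := by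
  suffices h : ∀ u : H ⊗[ℂ] H, ∃ a : ℕ →₀ A, ∀ f : ℕ → A,
      LinearMap.mul' ℂ A (TensorProduct.map φ.ofConv (gradedMul 𝓗 f ψ).ofConv u) =
        a.sum fun n u => f n * u from h (Coalgebra.comul x)
  have hadd : ∀ (a b : ℕ →₀ A) (f : ℕ → A), ((a + b).sum fun n u => f n * u) =
      (a.sum fun n u => f n * u) + b.sum fun n u => f n * u := fun a b f =>
    Finsupp.sum_add_index' (by simp) (by simp [mul_add])
  intro u
  induction u with
  | zero => exact ⟨0, by simp⟩
  | add u v hu hv =>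
    obtain ⟨a, ha⟩ := hu
    obtain ⟨b, hb⟩ := hv
    exact ⟨a + b, fun f => by rw [map_add, map_add, ha, hb, hadd]⟩
  | tmul x y =>
    induction y using DirectSum.Decomposition.inductionOn 𝓗 with
    | zero => exact ⟨0, by simp⟩
    | add y z hy hz =>
      obtain ⟨a, ha⟩ := hy
      obtain ⟨b, hb⟩ := hz
      exact ⟨a + b, fun f => by rw [TensorProduct.tmul_add, map_add, map_add, ha, hb, hadd]⟩
    | @homogeneous n y =>
      refine ⟨Finsupp.single n (φ x * ψ y), fun f => ?_⟩
      rw [Finsupp.sum_single_index (by simp), TensorProduct.map_tmul, LinearMap.mul'_apply]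
      rw [gradedMul_of_mem f ψ y.2]
      ring

/-! #### Inverses of elements of `G` -/

theorem one_sub_mem_g {φ : WithConv (H →ₗ[ℂ] A)} (hφ : φ ∈ G H A) : 1 - φ ∈ g H A := by
  have hG : φ.ofConv 1 = 1 := hφ
  change (1 - φ : WithConv (H →ₗ[ℂ] A)).ofConv 1 = 0
  rw [WithConv.ofConv_sub, LinearMap.sub_apply, hG, LinearMap.convOne_apply]
  simp

theorem sum_apply {ι : Type*} (s : Finset ι) (f : ι → WithConv (H →ₗ[ℂ] A)) (x : H) :
    (∑ i ∈ s, f i) x = ∑ i ∈ s, f i x := by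
  induction s using Finset.cons_induction with
  | empty => simp
  | cons a s ha ih => rw [Finset.sum_cons, Finset.sum_cons, ← ih]; rfl

/-- Geometric series for `φ = e - (e - φ)`: the remainder after `N` terms is `φ^{*-1} * (e - φ)^N`,
which vanishes below degree `N`. -/
theorem inverse_apply_of_mem (h𝓗 : IsConnectedGradedHopf 𝓗) {φ : WithConv (H →ₗ[ℂ] A)}
    (hφ : φ ∈ G H A) {N n : ℕ} (hn : n < N) {x : H} (hx : x ∈ 𝓗 n) :
    Ring.inverse φ x = ∑ k ∈ Finset.range N, ((1 - φ) ^ k : WithConv (H →ₗ[ℂ] A)) x := by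
  have hu := isUnit_of_mem_G h𝓗 hφ
  have e : Ring.inverse φ - ∑ k ∈ Finset.range N, (1 - φ) ^ k =
      Ring.inverse φ * (1 - φ) ^ N := by
    have h := mul_neg_geom_sum (1 - φ) N
    rw [sub_sub_cancel] at h
    have h2 := congrArg (Ring.inverse φ * ·) h
    simp only [← mul_assoc, Ring.inverse_mul_cancel _ hu, one_mul, mul_sub, mul_one] at h2
    rw [h2, sub_sub_cancel]
  have hv : VanishesBelow 𝓗 0 (Ring.inverse φ) := fun m hm => absurd hm (Nat.not_lt_zero m)
  have h0 := hv.mul h𝓗 (VanishesBelow.pow h𝓗 (one_sub_mem_g hφ) N) n (by omega) x hx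
  rw [← e] at h0
  rw [← sum_apply]
  exact sub_eq_zero.1 h0

theorem inverse_mem_G (h𝓗 : IsConnectedGradedHopf 𝓗) {φ : WithConv (H →ₗ[ℂ] A)}
    (hφ : φ ∈ G H A) : Ring.inverse φ ∈ G H A := by
  change Ring.inverse φ 1 = 1
  rw [inverse_apply_of_mem h𝓗 hφ Nat.zero_lt_one SetLike.GradedOne.one_mem]
  simp

/-- In the geometric series only the zeroth term `e` can leave the non-unital subalgebra `B`; every
other term is a convolution power of `e - φ`. -/
theorem inverse_sub_one_mem (h𝓗 : IsConnectedGradedHopf 𝓗) {φ : WithConv (H →ₗ[ℂ] A)}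
    (hφ : φ ∈ G H A) {B : NonUnitalSubalgebra ℂ A}
    (hB : ∀ x, (φ - 1 : WithConv (H →ₗ[ℂ] A)) x ∈ B) (x : H) :
    (Ring.inverse φ - 1 : WithConv (H →ₗ[ℂ] A)) x ∈ B := by
  have hB' : ∀ x, (1 - φ : WithConv (H →ₗ[ℂ] A)) x ∈ B := fun x => by
    rw [← neg_sub]
    exact neg_mem (hB x)
  have hpow : ∀ k x, ((1 - φ) ^ (k + 1) : WithConv (H →ₗ[ℂ] A)) x ∈ B := by
    intro k
    induction k with
    | zero => simpa using hB'
    | succ k ih =>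
      rw [pow_succ]
      exact convMul_mem (S := B.toSubmodule) (T := B.toSubmodule) (U := B.toSubmodule)
        (fun s hs t ht => B.mul_mem hs ht) ih hB'
  refine forall_mem_of_homogeneous (𝓗 := 𝓗) (S := B.toSubmodule) (fun n x hx => ?_) x
  change Ring.inverse φ x - (1 : WithConv (H →ₗ[ℂ] A)) x ∈ B
  rw [inverse_apply_of_mem h𝓗 hφ (Nat.lt_succ_self n) hx, Finset.sum_range_succ', pow_zero,
    add_sub_cancel_right]
  exact sum_mem fun k _ => hpow k x

/-! #### Maps which vanish on commutators -/

/-- As `Δ` is multiplicative, `(α * β)(xy)` is the sum of `α(x₁y₁) β(x₂y₂)`, and each factor is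
symmetric separately. -/
theorem convMul_comm_apply {α β : WithConv (H →ₗ[ℂ] A)} (hα : ∀ x y, α (x * y) = α (y * x))
    (hβ : ∀ x y, β (x * y) = β (y * x)) (x y : H) : (α * β) (x * y) = (α * β) (y * x) := by
  rw [convMul_apply_mul α β (Coalgebra.Repr.arbitrary ℂ x) (Coalgebra.Repr.arbitrary ℂ y),
    convMul_apply_mul α β (Coalgebra.Repr.arbitrary ℂ y) (Coalgebra.Repr.arbitrary ℂ x),
    Finset.sum_comm]
  refine Finset.sum_congr rfl fun i _ => Finset.sum_congr rfl fun j _ => ?_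
  rw [hα, hβ]

theorem convOne_comm_apply (x y : H) :
    (1 : WithConv (H →ₗ[ℂ] A)) (x * y) =
    (1 : WithConv (H →ₗ[ℂ] A)) (y * x) := by
  simp [mul_comm]

theorem convPow_comm_apply {α : WithConv (H →ₗ[ℂ] A)} (hα : ∀ x y, α (x * y) = α (y * x))
    (k : ℕ) (x y : H) : (α ^ k) (x * y) = (α ^ k) (y * x) := by
  induction k generalizing x y with
  | zero => simpa using convOne_comm_apply (A := A) x y
  | succ k ih => rw [pow_succ]; exact convMul_comm_apply ih hα x y

theorem comm_apply_of_homogeneous {φ : WithConv (H →ₗ[ℂ] A)}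
    (h : ∀ p q, ∀ x ∈ 𝓗 p, ∀ y ∈ 𝓗 q, φ (x * y) = φ (y * x)) (x y : H) :
    φ (x * y) = φ (y * x) := by
  have := bilin_eq_zero_of_homogeneous (𝓗 := 𝓗)
    (B := (LinearMap.mul ℂ H).compr₂ φ.ofConv - (LinearMap.mul ℂ H).flip.compr₂ φ.ofConv)
    (fun p q x hx y hy => by simpa [sub_eq_zero] using h p q x hx y hy) x y
  simpa [sub_eq_zero] using this

theorem mul_mem_degree {p q : ℕ} {x y : H} (hx : x ∈ 𝓗 p) (hy : y ∈ 𝓗 q) :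
    x * y ∈ 𝓗 (p + q) := SetLike.GradedMul.mul_mem hx hy

theorem mul_mem_degree' {p q : ℕ} {x y : H} (hx : x ∈ 𝓗 p) (hy : y ∈ 𝓗 q) :
    y * x ∈ 𝓗 (p + q) := add_comm q p ▸ SetLike.GradedMul.mul_mem hy hx

theorem inverse_comm_apply (h𝓗 : IsConnectedGradedHopf 𝓗) {φ : WithConv (H →ₗ[ℂ] A)}
    (hφ : φ ∈ G₂ H A) (x y : H) : Ring.inverse φ (x * y) = Ring.inverse φ (y * x) := by
  refine comm_apply_of_homogeneous (𝓗 := 𝓗) (fun p q x hx y hy => ?_) x y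
  rw [inverse_apply_of_mem h𝓗 hφ.1 (Nat.lt_succ_self (p + q)) (mul_mem_degree hx hy),
    inverse_apply_of_mem h𝓗 hφ.1 (Nat.lt_succ_self (p + q)) (mul_mem_degree' hx hy)]
  refine Finset.sum_congr rfl fun k _ => convPow_comm_apply (fun x y => ?_) k x y
  change (1 : WithConv (H →ₗ[ℂ] A)) (x * y) - φ (x * y) =
    (1 : WithConv (H →ₗ[ℂ] A)) (y * x) - φ (y * x)
  rw [hφ.2 x y, convOne_comm_apply]

theorem compY_comm_apply {φ : WithConv (H →ₗ[ℂ] A)} (hφ : ∀ x y, φ (x * y) = φ (y * x))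
    (x y : H) : compY 𝓗 φ (x * y) = compY 𝓗 φ (y * x) := by
  refine comm_apply_of_homogeneous (𝓗 := 𝓗) (fun p q x hx y hy => ?_) x y
  rw [compY_of_mem φ (mul_mem_degree hx hy), compY_of_mem φ (mul_mem_degree' hx hy), hφ]

theorem renormMap_mem_g₂ (h𝓗 : IsConnectedGradedHopf 𝓗) {φ : WithConv (H →ₗ[ℂ] A)}
    (hφ : φ ∈ G₂ H A) : renormMap 𝓗 φ ∈ g₂ H A :=
  ⟨((mem_g_and_compY_eq_iff h𝓗 hφ.1 _).2 rfl).1,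
    convMul_comm_apply (inverse_comm_apply h𝓗 hφ) (compY_comm_apply hφ.2)⟩

/-! #### Characters and derivations -/

theorem Y_mul (x y : H) : Y 𝓗 (x * y) = Y 𝓗 x * y + x * Y 𝓗 y := by
  induction x using DirectSum.Decomposition.inductionOn 𝓗 with
  | zero => simp
  | add a b ha hb => rw [add_mul, map_add, ha, hb, map_add, add_mul, add_mul]; abel
  | @homogeneous p x =>
    induction y using DirectSum.Decomposition.inductionOn 𝓗 with
    | zero => simp
    | add a b ha hb => rw [mul_add, map_add, ha, hb, map_add, mul_add, mul_add]; abel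
    | @homogeneous q y =>
      rw [Y_of_mem 𝓗 (mul_mem_degree x.2 y.2), Y_of_mem 𝓗 x.2, Y_of_mem 𝓗 y.2]
      simp [add_smul]

theorem convMul_apply_eq_sum (α β : WithConv (H →ₗ[ℂ] A)) {x : H} {ι : Type*}
    (r : Coalgebra.Repr ℂ x ι) : (α * β) x = ∑ i ∈ r.index, α (r.left i) * β (r.right i) :=
  r.convMul_apply α β

/-- Let `E` be the derivation defect of `γ`. Convolving `E` with `φ` in both variables and using
`φ(x₁)φ(y₁) = φ(x₁y₁)` turns it into the defect of the Leibniz rule for `φ ∘ Y`, which is zero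
because `Y` is a derivation. Invertibility of `φ` then removes the two convolutions one at a time.
-/
theorem renormMap_mem_g₁ (h𝓗 : IsConnectedGradedHopf 𝓗) {φ : WithConv (H →ₗ[ℂ] A)}
    (hφ : φ ∈ G₁ H A) : renormMap 𝓗 φ ∈ g₁ H A := by
  obtain ⟨hγ, hY⟩ := (mem_g_and_compY_eq_iff h𝓗 hφ.1 _).2 rfl
  have hu := isUnit_of_mem_G h𝓗 hφ.1
  set γ := renormMap 𝓗 φ
  let e : WithConv (H →ₗ[ℂ] A) := 1
  let E : H →ₗ[ℂ] H →ₗ[ℂ] A := (LinearMap.mul ℂ H).compr₂ γ.ofConv -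
    ((LinearMap.mul ℂ A).compl₁₂ e.ofConv γ.ofConv + (LinearMap.mul ℂ A).compl₁₂ γ.ofConv e.ofConv)
  have hE : ∀ x y, E x y = γ (x * y) - (e x * γ y + γ x * e y) := fun x y => by simp [E]
  -- Convolution with `φ` in the second variable only; the first variable is treated through
  -- `F.flip`.
  let F : H →ₗ[ℂ] H →ₗ[ℂ] A :=
    { toFun := fun x => (φ * WithConv.toConv (E x) : WithConv (H →ₗ[ℂ] A)).ofConv
      map_add' := fun x y => by simp [mul_add]
      map_smul' := fun c x => by simp }
  have hF : ∀ x y, F x y = (φ * WithConv.toConv (E x) : WithConv (H →ₗ[ℂ] A)) y :=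
    fun x y => rfl
  have inj : ∀ L : H →ₗ[ℂ] A, (∀ x, (φ * WithConv.toConv L : WithConv (H →ₗ[ℂ] A)) x = 0) →
      L = 0 := by
    intro L hL
    have h0 : φ * WithConv.toConv L = 0 := by ext x; exact hL x
    have := hu.mul_right_eq_zero.1 h0
    exact congrArg WithConv.ofConv this
  have hF0 : ∀ y, F.flip y = 0 := by
    intro y
    refine inj _ fun x => ?_
    let r := Coalgebra.Repr.arbitrary ℂ x
    let s := Coalgebra.Repr.arbitrary ℂ y
    have key : (φ * WithConv.toConv (F.flip y) : WithConv (H →ₗ[ℂ] A)) x =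
        (φ * γ) (x * y) - ((φ * e) x * (φ * γ) y + (φ * γ) x * (φ * e) y) := by
      rw [convMul_apply_mul φ γ r s, convMul_apply_eq_sum φ e r, convMul_apply_eq_sum φ γ r,
        convMul_apply_eq_sum φ e s, convMul_apply_eq_sum φ γ s, convMul_apply_eq_sum _ _ r,
        Finset.sum_mul_sum, Finset.sum_mul_sum, ← Finset.sum_add_distrib,
        ← Finset.sum_sub_distrib]
      refine Finset.sum_congr rfl fun i _ => ?_
      rw [← Finset.sum_add_distrib, ← Finset.sum_sub_distrib]
      change φ _ * F (r.right i) y = _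
      rw [hF, convMul_apply_eq_sum _ _ s, Finset.mul_sum]
      refine Finset.sum_congr rfl fun j _ => ?_
      change φ _ * (φ _ * E _ _) = _
      rw [hE, hφ.2]
      ring
    rw [key, ← hY, mul_one]
    change φ.ofConv (Y 𝓗 (x * y)) - (φ x * φ (Y 𝓗 y) + φ (Y 𝓗 x) * φ y) = 0
    rw [Y_mul, map_add, hφ.2, hφ.2]
    ring
  intro x y
  have hEx : E x = 0 := inj _ fun y => by
    rw [← hF]
    exact LinearMap.congr_fun (hF0 y) x
  exact sub_eq_zero.1 ((hE x y).symm.trans (by rw [hEx]; rfl))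

/-- In `φ(x₁y₁) γ(x₂y₂)` the derivation rule puts a counit on `x₂` or on `y₂`, which collapses `x₁`
to `x` or `y₁` to `y`. No multiplicativity of `φ` is needed. -/
theorem convMul_apply_mul_of_mem_g₁ (φ : WithConv (H →ₗ[ℂ] A)) {γ : WithConv (H →ₗ[ℂ] A)}
    (hγ : γ ∈ g₁ H A) (x y : H) :
    (φ * γ) (x * y) =
      (WithConv.toConv (φ.ofConv ∘ₗ LinearMap.mulRight ℂ y) * γ : WithConv (H →ₗ[ℂ] A)) x +
      (WithConv.toConv (φ.ofConv ∘ₗ LinearMap.mulLeft ℂ x) * γ : WithConv (H →ₗ[ℂ] A)) y := by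
  let r := Coalgebra.Repr.arbitrary ℂ x
  let s := Coalgebra.Repr.arbitrary ℂ y
  have hr : ∑ i ∈ r.index, Coalgebra.counit (R := ℂ) (r.right i) • r.left i = x := by
    have h := congrArg (TensorProduct.rid ℂ H) (Coalgebra.sum_tmul_counit_eq r)
    rw [map_sum, TensorProduct.rid_tmul, one_smul] at h
    exact h
  have hs : ∑ j ∈ s.index, Coalgebra.counit (R := ℂ) (s.right j) • s.left j = y := by
    have h := congrArg (TensorProduct.rid ℂ H) (Coalgebra.sum_tmul_counit_eq s)
    rw [map_sum, TensorProduct.rid_tmul, one_smul] at h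
    exact h
  rw [convMul_apply_mul φ γ r s, convMul_apply_eq_sum _ _ r, convMul_apply_eq_sum _ _ s]
  -- The collapsed variables are expanded again by the counit axiom, so that both sides become
  -- double sums compared termwise.
  have h1 : ∀ i, φ (r.left i * y) = ∑ j ∈ s.index,
      Coalgebra.counit (R := ℂ) (s.right j) • φ (r.left i * s.left j) := by
    intro i
    conv_lhs => rw [← hs]
    simp [Finset.mul_sum, map_sum]
  have h2 : ∀ j, φ (x * s.left j) = ∑ i ∈ r.index,
      Coalgebra.counit (R := ℂ) (r.right i) • φ (r.left i * s.left j) := by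
    intro j
    conv_lhs => rw [← hr]
    simp [Finset.sum_mul, map_sum]
  change _ = ∑ i ∈ r.index, φ (r.left i * y) * γ (r.right i) +
    ∑ j ∈ s.index, φ (x * s.left j) * γ (s.right j)
  simp only [h1, h2, Finset.sum_mul]
  rw [Finset.sum_comm (s := s.index) (t := r.index), ← Finset.sum_add_distrib]
  refine Finset.sum_congr rfl fun i _ => ?_
  rw [← Finset.sum_add_distrib]
  refine Finset.sum_congr rfl fun j _ => ?_
  rw [hγ, LinearMap.convOne_apply, LinearMap.convOne_apply, Algebra.smul_def, Algebra.smul_def]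
  ring

end Convolution

/-! ### Polar and holomorphic germs, residues -/

section Germs

theorem exists_eq_of (a : Mero) : ∃ f hf, a = Mero.of f hf := by
  obtain ⟨_, f, hf, rfl⟩ := a
  exact ⟨f, hf, rfl⟩

theorem zInvGerm_mul_zGerm : zInvGerm * zGerm = 1 := by
  rw [mul_comm, zGerm_mul_zInvGerm]

theorem zGerm_mul_cancel_left (a : Mero) : zGerm * (zInvGerm * a) = a := by
  rw [← mul_assoc, zGerm_mul_zInvGerm, one_mul]

theorem zInvGerm_mul_cancel_left (a : Mero) : zInvGerm * (zGerm * a) = a := by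
  rw [← mul_assoc, zInvGerm_mul_zGerm, one_mul]

/-- Evaluation of a polynomial at a germ is computed pointwise. -/
theorem coe_aeval (g : ℂ → ℂ) (hg : MeromorphicAt g 0) (p : Polynomial ℂ) :
    ((Polynomial.aeval (Mero.of g hg) p : Mero) : Germ (𝓝[≠] (0 : ℂ)) ℂ) =
      ((fun z => p.eval (g z) : ℂ → ℂ) : Germ (𝓝[≠] (0 : ℂ)) ℂ) := by
  induction p using Polynomial.induction_on' with
  | add p q hp hq =>
    rw [map_add, AddMemClass.coe_add, hp, hq]
    simp only [Polynomial.eval_add]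
    rfl
  | monomial n c =>
    rw [Polynomial.aeval_monomial, MulMemClass.coe_mul]
    simp only [Polynomial.eval_monomial]
    change algebraMap ℂ (Germ (𝓝[≠] (0 : ℂ)) ℂ) c * _ = _
    rw [germ_algebraMap, SubmonoidClass.coe_pow]
    rfl

/-- Expresses `𝒜₋` inside the algebra of germs, so that later steps can manipulate the polynomial
instead of functions. -/
theorem mem_polarGerms_iff {a : Mero} :
    a ∈ polarGerms ↔ ∃ p : Polynomial ℂ, a = zInvGerm * Polynomial.aeval zInvGerm p := by
  have h : ∀ p : Polynomial ℂ, ((zInvGerm * Polynomial.aeval zInvGerm p : Mero) :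
      Germ (𝓝[≠] (0 : ℂ)) ℂ) =
      ((fun z => z⁻¹ * p.eval z⁻¹ : ℂ → ℂ) : Germ (𝓝[≠] (0 : ℂ)) ℂ) := by
    intro p
    rw [MulMemClass.coe_mul, zInvGerm, coe_aeval]
    rfl
  refine exists_congr fun p => ?_
  rw [← h p]
  exact Subtype.ext_iff.symm

theorem hasLaurentExpansion_polar (p : Polynomial ℂ) :
    HasLaurentExpansion (zInvGerm * Polynomial.aeval zInvGerm p)
      (fun n => if n < 0 then p.coeff (-n - 1).toNat else 0) := by
  refine ⟨⟨-p.natDegree - 1, fun n hn => ?_⟩, fun z => z⁻¹ * p.eval z⁻¹, ?_, ?_⟩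
  · simp only [if_pos (show n < 0 by omega)]
    exact Polynomial.coeff_eq_zero_of_natDegree_lt (by omega)
  · rw [MulMemClass.coe_mul, zInvGerm, coe_aeval]
    rfl
  · filter_upwards [self_mem_nhdsWithin] with z hz
    have hz0 : z ≠ 0 := hz
    -- The factor `z⁻¹` shifts exponents: `p.coeff k` is the coefficient of `z^(-k-1)`.
    have inj : Function.Injective (fun k : ℕ => -(k : ℤ) - 1) := fun a b h => by
      simp only [] at h; omega
    rw [← inj.hasSum_iff]
    · have e : (fun n : ℤ => (if n < 0 then p.coeff (-n - 1).toNat else 0) * z ^ n) ∘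
          (fun k : ℕ => -(k : ℤ) - 1) = fun k : ℕ => z⁻¹ * (p.coeff k * z⁻¹ ^ k) := by
        funext k
        have h2 : (-(-(k : ℤ) - 1) - 1).toNat = k := by omega
        simp only [Function.comp_apply, h2, if_pos (show -(k : ℤ) - 1 < 0 by omega)]
        rw [zpow_sub₀ hz0, zpow_neg, zpow_natCast, zpow_one, inv_pow]
        field_simp
      rw [e]
      refine HasSum.mul_left _ ?_
      rw [Polynomial.eval_eq_sum_range]
      refine hasSum_sum_of_ne_finset_zero fun k hk => ?_
      rw [Polynomial.coeff_eq_zero_of_natDegree_lt (by simpa using hk), zero_mul]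
    · intro m hm
      have : ¬ m < 0 := fun h => hm ⟨(-m - 1).toNat, by simp only []; omega⟩
      simp [this]

theorem residue_polar (p : Polynomial ℂ) :
    residue (zInvGerm * Polynomial.aeval zInvGerm p) = p.coeff 0 := by
  rw [(hasLaurentExpansion_polar p).residue_eq]
  simp

theorem exists_hasLaurentExpansion_of_mem_holoGerms {a : Mero} (ha : a ∈ holoGerms) :
    ∃ c, HasLaurentExpansion a c ∧ ∀ n < 0, c n = 0 := by
  obtain ⟨f, ⟨p, hp⟩, haf⟩ := ha
  refine ⟨fun n => if n < 0 then 0 else p.coeff n.toNat, ⟨⟨0, fun n hn => if_pos hn⟩, f, haf, ?_⟩,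
    fun n hn => if_pos hn⟩
  have hp' := (hasFPowerSeriesAt_iff.1 hp).filter_mono (nhdsWithin_le_nhds (s := {0}ᶜ))
  filter_upwards [hp'] with z hz
  rw [← Nat.cast_injective.hasSum_iff]
  · refine (congrArg₂ HasSum (funext fun k => ?_) (by rw [zero_add])).mpr hz
    simp [mul_comm]
  · intro m hm
    have : m < 0 := by
      by_contra h
      exact hm ⟨m.toNat, by omega⟩
    simp [this]

/-- Uniqueness of the Laurent expansion: one expansion has no negative powers, the other only
negative ones. -/
theorem eq_zero_of_mem_polarGerms_of_mem_holoGerms {a : Mero} (hp : a ∈ polarGerms)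
    (hh : a ∈ holoGerms) : a = 0 := by
  obtain ⟨p, rfl⟩ := mem_polarGerms_iff.1 hp
  obtain ⟨c, hc, hc0⟩ := exists_hasLaurentExpansion_of_mem_holoGerms hh
  have := hc.unique (hasLaurentExpansion_polar p)
  have hp0 : p = 0 := by
    ext k
    have h := congrFun this (-(k : ℤ) - 1)
    rw [hc0 _ (by omega), if_pos (by omega)] at h
    rw [show (-(-(k : ℤ) - 1) - 1).toNat = k by omega] at h
    simpa using h.symm
  rw [hp0, map_zero, mul_zero]

/-- `z 𝒜₋ ∩ 𝒜₊ = ℂ`. -/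
theorem exists_eq_const_of_mem {a : Mero} (hp : a ∈ polarGerms) (hh : zGerm * a ∈ holoGerms) :
    ∃ c : ℂ, zGerm * a = algebraMap ℂ Mero c := by
  obtain ⟨p, rfl⟩ := mem_polarGerms_iff.1 hp
  rw [zGerm_mul_cancel_left] at hh ⊢
  refine ⟨p.coeff 0, ?_⟩
  -- Writing `p = X * p.divX + p.coeff 0` shows that `z a` minus the constant term of `p` is again
  -- polar; it is also holomorphic, hence zero.
  have e : Polynomial.aeval zInvGerm p - algebraMap ℂ Mero (p.coeff 0) =
      zInvGerm * Polynomial.aeval zInvGerm p.divX := by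
    have h := congrArg (Polynomial.aeval zInvGerm) (Polynomial.X_mul_divX_add p)
    rw [map_add, map_mul, Polynomial.aeval_X, Polynomial.aeval_C] at h
    rw [← h, add_sub_cancel_right]
  refine sub_eq_zero.1 (eq_zero_of_mem_polarGerms_of_mem_holoGerms
    (mem_polarGerms_iff.2 ⟨_, e⟩) ?_)
  exact sub_mem hh (holoGerms.algebraMap_mem _)

theorem zInvGerm_mul_const_mem (c : ℂ) : zInvGerm * algebraMap ℂ Mero c ∈ polarGerms :=
  mem_polarGerms_iff.2 ⟨Polynomial.C c, by simp⟩

/-- Elements of `z⁻¹ 𝒜₋` start at `z⁻²` and contribute no residue. -/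
theorem residue_add_zInvGerm_mul (c : ℂ) {a : Mero} (ha : a ∈ polarGerms) :
    residue (zInvGerm * algebraMap ℂ Mero c + zInvGerm * a) = c := by
  obtain ⟨p, rfl⟩ := mem_polarGerms_iff.1 ha
  have := residue_polar (Polynomial.C c + Polynomial.X * p)
  simpa [mul_add] using this

theorem zGerm_mem_holoGerms : zGerm ∈ holoGerms := ⟨fun z => z, analyticAt_id, rfl⟩

theorem exists_zGerm_pow_mul_mem (a : Mero) : ∃ M, zGerm ^ M * a ∈ holoGerms := by
  obtain ⟨f, ⟨M, hM⟩, rfl⟩ := exists_eq_of a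
  refine ⟨M, _, hM, ?_⟩
  rw [MulMemClass.coe_mul, SubmonoidClass.coe_pow]
  refine congrArg _ (funext fun z => ?_)
  simp

theorem exists_zGerm_pow_mul_mem_of_finset {ι : Type*} (s : Finset ι) (a : ι → Mero) :
    ∃ M, ∀ i ∈ s, ∀ N ≥ M, zGerm ^ N * a i ∈ holoGerms := by
  choose M hM using fun i => exists_zGerm_pow_mul_mem (a i)
  refine ⟨s.sup M, fun i hi N hN => ?_⟩
  have h : M i ≤ N := (Finset.le_sup hi).trans hN
  rw [← Nat.sub_add_cancel h, pow_add, mul_assoc]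
  exact mul_mem (pow_mem zGerm_mem_holoGerms _) (hM i)

/-! ### Expansion of `e^{tnz}` in powers of `t` modulo holomorphic germs -/

/-- Taylor's formula: `dslope` at `0` sends `f` to `(f(z) - f(0)) / z`, extended by the derivative
at `z = 0`, so each iteration splits off one more coefficient. -/
theorem eq_sum_add_pow_mul_iterate_dslope {f : ℂ → ℂ} {p : FormalMultilinearSeries ℂ ℂ ℂ}
    (hp : HasFPowerSeriesAt f p 0) (K : ℕ) (z : ℂ) :
    f z = ∑ k ∈ Finset.range K, p.coeff k * z ^ k +
      z ^ K * ((Function.swap dslope 0)^[K] f) z := by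
  induction K with
  | zero => simp
  | succ K ih =>
    have h0 : ((Function.swap dslope 0)^[K] f) 0 = p.coeff K := by
      rw [← (HasFPowerSeriesAt.has_fpower_series_iterate_dslope_fslope K hp).coeff_zero 1,
        ← FormalMultilinearSeries.coeff, FormalMultilinearSeries.coeff_iterate_fslope, zero_add]
    rw [ih, Finset.sum_range_succ, Function.iterate_succ_apply']
    have h1 := sub_smul_dslope ((Function.swap dslope 0)^[K] f) 0 z
    rw [h0, sub_zero, smul_eq_mul] at h1
    change _ = _ + z ^ (K + 1) * dslope ((Function.swap dslope 0)^[K] f) 0 z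
    rw [pow_succ, mul_assoc, h1]
    ring

theorem expGerm_eq (c : ℂ) (K : ℕ) : ∃ h ∈ holoGerms, expGerm c =
    ∑ k ∈ Finset.range K, ((k.factorial : ℂ)⁻¹ * c ^ k) • zGerm ^ k + zGerm ^ K * h := by
  have hp : HasFPowerSeriesAt (fun z => Complex.exp (c * z))
      (FormalMultilinearSeries.ofScalars ℂ fun k => ((k.factorial : ℂ)⁻¹ * c ^ k)) 0 := by
    rw [hasFPowerSeriesAt_iff]
    refine Eventually.of_forall fun z => ?_
    have := NormedSpace.expSeries_div_hasSum_exp (c * z)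
    rw [← Complex.exp_eq_exp_ℂ] at this
    rw [zero_add]
    refine (congrArg (fun u => HasSum u _) (funext fun k => ?_)).mpr this
    simp only [FormalMultilinearSeries.coeff_ofScalars, smul_eq_mul, mul_pow]
    ring
  have ha := (HasFPowerSeriesAt.has_fpower_series_iterate_dslope_fslope K hp).analyticAt
  refine ⟨Mero.of _ ha.meromorphicAt, ⟨_, ha, rfl⟩, ?_⟩
  -- The Taylor sum becomes a polynomial evaluated at the germ `z`, so that `coe_aeval` makes it a
  -- pointwise statement.
  let P : Polynomial ℂ := ∑ k ∈ Finset.range K,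
    Polynomial.monomial k ((k.factorial : ℂ)⁻¹ * c ^ k)
  have hP : ∑ k ∈ Finset.range K, ((k.factorial : ℂ)⁻¹ * c ^ k) • zGerm ^ k =
      Polynomial.aeval zGerm P := by
    simp [P, map_sum, Polynomial.aeval_monomial, Algebra.smul_def]
  rw [hP]
  apply Subtype.ext
  rw [AddMemClass.coe_add, MulMemClass.coe_mul, SubmonoidClass.coe_pow, zGerm, coe_aeval]
  refine congrArg _ (funext fun z => ?_)
  have := eq_sum_add_pow_mul_iterate_dslope hp K z
  simp only [FormalMultilinearSeries.coeff_ofScalars] at this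
  simpa [P, Polynomial.eval_finsetSum] using this

/-- Truncation of `∑ₙ exp (t n z) aₙ` modulo holomorphic germs. -/
theorem exists_sum_expGerm_sub_mem (a : ℕ →₀ Mero) : ∃ M, ∀ K ≥ M, ∀ t : ℂ,
    (a.sum fun n u => expGerm (t * n) * u) -
      ∑ k ∈ Finset.range K, t ^ k • ((k.factorial : ℂ)⁻¹ •
        a.sum fun n u => ((n : ℂ) • zGerm) ^ k * u) ∈ holoGerms := by
  obtain ⟨M, hM⟩ := exists_zGerm_pow_mul_mem_of_finset a.support a
  refine ⟨M, fun K hK t => ?_⟩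
  simp only [Finsupp.sum, Finset.smul_sum]
  rw [Finset.sum_comm, ← Finset.sum_sub_distrib]
  refine sum_mem fun n hn => ?_
  -- The Taylor remainder contributes `h z^K a n`, which is holomorphic because `M` bounds all pole
  -- orders in the support, uniformly in `t`.
  obtain ⟨h, hh, e⟩ := expGerm_eq (t * n) K
  have : expGerm (t * n) * a n - ∑ k ∈ Finset.range K,
      t ^ k • (k.factorial : ℂ)⁻¹ • (((n : ℂ) • zGerm) ^ k * a n) = h * (zGerm ^ K * a n) := by
    rw [e, add_mul, Finset.sum_mul]
    have : ∀ k, ((k.factorial : ℂ)⁻¹ * (t * n) ^ k) • zGerm ^ k * a n =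
        t ^ k • (k.factorial : ℂ)⁻¹ • (((n : ℂ) • zGerm) ^ k * a n) := by
      intro k
      rw [smul_pow, smul_mul_assoc, smul_mul_assoc, smul_smul, smul_smul]
      congr 1
      ring
    simp only [this]
    ring
  rw [this]
  exact mul_mem hh (hM n hn K hK)

/-- Composed with any linear functional on `V / S`, the sum is a polynomial function of `t`
vanishing on all of `ℂ`, so its coefficients are zero; functionals separate the points of `V / S`.
-/
theorem mem_of_forall_sum_pow_smul_mem {V : Type*} [AddCommGroup V] [Module ℂ V]
    (S : Submodule ℂ V) {K : ℕ} {b : ℕ → V}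
    (h : ∀ t : ℂ, ∑ k ∈ Finset.range K, t ^ k • b k ∈ S) {k : ℕ} (hk : k < K) : b k ∈ S := by
  rw [← Submodule.Quotient.mk_eq_zero, ← Module.forall_dual_apply_eq_zero_iff ℂ]
  intro l
  let P : Polynomial ℂ := ∑ k ∈ Finset.range K, Polynomial.monomial k (l (S.mkQ (b k)))
  have hP : P = 0 := by
    refine Polynomial.funext fun t => ?_
    have h1 : l (S.mkQ (∑ k ∈ Finset.range K, t ^ k • b k)) = 0 := by
      rw [(Submodule.mkQ_apply S _).trans ((Submodule.Quotient.mk_eq_zero S).2 (h t)), map_zero]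
    simp only [map_sum, map_smul, smul_eq_mul] at h1
    simpa [P, Polynomial.eval_finsetSum, mul_comm] using h1
  have h2 := congrArg (fun Q => Polynomial.coeff Q k) hP
  simpa [P, Polynomial.finsetSum_coeff, Polynomial.coeff_monomial, hk] using h2

/-- Modulo `𝒜₊` the left-hand family is a polynomial in `t` whose coefficients are the right-hand
sums divided by `k!`. -/
theorem sum_expGerm_mem_iff (a : ℕ →₀ Mero) :
    (∀ t : ℂ, (a.sum fun n u => expGerm (t * n) * u) ∈ holoGerms) ↔
      ∀ k, (a.sum fun n u => ((n : ℂ) • zGerm) ^ k * u) ∈ holoGerms := by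
  obtain ⟨M, hM⟩ := exists_sum_expGerm_sub_mem a
  constructor
  · intro h k
    -- `M` makes the truncation valid, and `k + 1` ensures that the coefficient of `t^k` occurs in
    -- it.
    have := mem_of_forall_sum_pow_smul_mem holoGerms.toSubmodule (K := max M (k + 1))
      (fun t => by
        have := sub_mem (h t) (hM (max M (k + 1)) (le_max_left _ _) t)
        rwa [sub_sub_cancel] at this) (k := k) (by omega)
    have h2 := holoGerms.smul_mem this (k.factorial : ℂ)
    rwa [smul_smul, mul_inv_cancel₀ (by exact_mod_cast k.factorial_ne_zero), one_smul] at h2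
  · intro h t
    have := hM M le_rfl t
    have h2 := add_mem this (sum_mem (t := Finset.range M) fun k _ =>
      holoGerms.smul_mem (holoGerms.smul_mem (h k) (k.factorial : ℂ)⁻¹) (t ^ k))
    rwa [sub_add_cancel] at h2

end Germs

/-! ### The counit in positive degree and the equation `ψ ∘ Y = ψ * γ` -/

section Convolution

variable {H A : Type*} [Ring H] [HopfAlgebra ℂ H] [CommRing A] [Algebra ℂ A]
  {𝓗 : ℕ → Submodule ℂ H} [GradedAlgebra 𝓗]

theorem exists_eq_smul_one (h𝓗 : IsConnectedGradedHopf 𝓗) {x : H} (hx : x ∈ 𝓗 0) :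
    ∃ c : ℂ, x = c • (1 : H) := by
  have h1 : (1 : H) ∈ 𝓗 0 := SetLike.GradedOne.one_mem
  have hv : (⟨1, h1⟩ : 𝓗 0) ≠ 0 := by
    intro h
    have := congrArg (fun v : 𝓗 0 => Coalgebra.counit (R := ℂ) (v : H)) h
    simp at this
  obtain ⟨c, hc⟩ := (finrank_eq_one_iff_of_nonzero' _ hv).1 h𝓗.connected ⟨x, hx⟩
  exact ⟨c, (congrArg Subtype.val hc).symm⟩

/-- The counit vanishes in positive degrees. -/
theorem counit_eq_zero_of_mem (h𝓗 : IsConnectedGradedHopf 𝓗) {n : ℕ} (hn : n ≠ 0) {x : H}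
    (hx : x ∈ 𝓗 n) : Coalgebra.counit (R := ℂ) x = 0 := by
  -- `e₀` is the counit cut off to degree `0`. It is a convolution idempotent in `G`, so `e - e₀` is
  -- an idempotent of `𝔤`; being equal to all its positive powers, it vanishes in every degree.
  let e₀ : WithConv (H →ₗ[ℂ] ℂ) := gradedMul 𝓗 (fun n => if n = 0 then 1 else 0) 1
  have h₀ : ∀ x ∈ 𝓗 0, e₀ x = (1 : WithConv (H →ₗ[ℂ] ℂ)) x := fun x hx => by
    simp [e₀, gradedMul_of_mem _ _ hx]
  have h₁ : ∀ n ≠ 0, ∀ x ∈ 𝓗 n, e₀ x = 0 := fun n hn x hx => by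
    simp [e₀, gradedMul_of_mem _ _ hx, hn]
  have hG : e₀ ∈ G H ℂ := by
    change e₀ 1 = 1
    rw [h₀ 1 SetLike.GradedOne.one_mem]
    simp
  have hg := one_sub_mem_g hG
  have idem : e₀ * e₀ = e₀ := by
    refine conv_ext_of_homogeneous (𝓗 := 𝓗) fun n x hx => ?_
    by_cases h0 : n = 0
    · subst h0
      obtain ⟨c, rfl⟩ := exists_eq_smul_one h𝓗 hx
      rw [map_smul, map_smul, convMul_one_right_apply _ _ hG]
    · rw [h₁ n h0 x hx]
      refine mul'_map_eq_zero_of_antidiagonal h𝓗 (L := LinearMap.mul' ℂ ℂ ∘ₗ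
        TensorProduct.map e₀.ofConv e₀.ofConv) (n := n) ?_ hx
      intro p q hpq x hx y hy
      rw [LinearMap.comp_apply, TensorProduct.map_tmul, LinearMap.mul'_apply]
      by_cases hp : p = 0
      · rw [h₁ q (by omega) y hy, mul_zero]
      · rw [h₁ p hp x hx, zero_mul]
  have idem' : IsIdempotentElem (1 - e₀) := IsIdempotentElem.one_sub idem
  have h1 : 1 - e₀ = 0 := eq_zero_of_vanishesBelow (𝓗 := 𝓗) fun N m hm x hx => by
    have := VanishesBelow.pow h𝓗 hg (N + 1) m (by omega) x hx
    rwa [idem'.pow_succ_eq] at this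
  have h2 := h₁ n hn x hx
  rw [← sub_eq_zero.1 h1] at h2
  simpa using h2

theorem mulBy_apply (f : A) (ψ : WithConv (H →ₗ[ℂ] A)) (x : H) : mulBy f ψ x = f * ψ x := rfl

theorem mulBy_convMul (f : A) (φ ψ : WithConv (H →ₗ[ℂ] A)) :
    mulBy f φ * ψ = mulBy f (φ * ψ) := by
  ext x
  rw [mulBy_apply, convMul_apply_eq_sum _ _ (Coalgebra.Repr.arbitrary ℂ x),
    convMul_apply_eq_sum _ _ (Coalgebra.Repr.arbitrary ℂ x), Finset.mul_sum]
  exact Finset.sum_congr rfl fun i _ => by rw [mulBy_apply, mul_assoc]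

theorem convMul_mulBy (f : A) (φ ψ : WithConv (H →ₗ[ℂ] A)) :
    φ * mulBy f ψ = mulBy f (φ * ψ) := by
  ext x
  rw [mulBy_apply, convMul_apply_eq_sum _ _ (Coalgebra.Repr.arbitrary ℂ x),
    convMul_apply_eq_sum _ _ (Coalgebra.Repr.arbitrary ℂ x), Finset.mul_sum]
  exact Finset.sum_congr rfl fun i _ => by rw [mulBy_apply, mul_left_comm]

theorem mulBy_add (f : A) (φ ψ : WithConv (H →ₗ[ℂ] A)) :
    mulBy f (φ + ψ) = mulBy f φ + mulBy f ψ := by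
  ext x
  exact mul_add _ _ _

/-! #### The equation `ψ ∘ Y = ψ * γ` -/

/-- Induction on the degree: if `E` vanishes below `N`, then `E * γ` vanishes below `N + 1` because
`γ` kills degree `0`, so `n E = 0` on `𝓗 n` for `n ≤ N`. Degree `0`, where `n` is not invertible, is
covered by `E ∈ 𝔤`. -/
theorem eq_zero_of_compY_eq_mul (h𝓗 : IsConnectedGradedHopf 𝓗) {γ E : WithConv (H →ₗ[ℂ] A)}
    (hγ : γ ∈ g H A) (hE : E ∈ g H A) (h : compY 𝓗 E = E * γ) : E = 0 := by
  refine eq_zero_of_vanishesBelow (𝓗 := 𝓗) fun N => ?_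
  induction N with
  | zero => exact fun n hn => absurd hn (Nat.not_lt_zero n)
  | succ N ih =>
    intro n hn x hx
    by_cases h0 : n = 0
    · exact VanishesBelow.one_of_mem_g h𝓗 hE n (by omega) x hx
    · have h1 := ih.mul h𝓗 (VanishesBelow.one_of_mem_g h𝓗 hγ) n hn x hx
      rw [← h, compY_of_mem E hx] at h1
      exact (smul_eq_zero.1 h1).resolve_left (Nat.cast_ne_zero.2 h0)

theorem eq_of_renormMap_eq (h𝓗 : IsConnectedGradedHopf 𝓗) {φ ψ : WithConv (H →ₗ[ℂ] A)}
    (hφ : φ ∈ G H A) (hψ : ψ ∈ G H A) (h : renormMap 𝓗 φ = renormMap 𝓗 ψ) : φ = ψ := by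
  obtain ⟨hγ, h1⟩ := (mem_g_and_compY_eq_iff h𝓗 hφ _).2 rfl
  obtain ⟨-, h2⟩ := (mem_g_and_compY_eq_iff h𝓗 hψ _).2 rfl
  refine sub_eq_zero.1 (eq_zero_of_compY_eq_mul h𝓗 hγ ?_ ?_)
  · change φ 1 - ψ 1 = 0
    rw [show φ 1 = 1 from hφ, show ψ 1 = 1 from hψ, sub_self]
  · rw [sub_mul, ← h1, h, ← h2]
    rfl

variable (𝓗) in
/-- The homogeneous terms of the solution of `ψ ∘ Y = ψ * γ` with respect to `γ`. -/
def expansionTerm (γ : WithConv (H →ₗ[ℂ] A)) : ℕ → WithConv (H →ₗ[ℂ] A)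
  | 0 => 1
  | k + 1 => gradedMul 𝓗 (fun n => algebraMap ℂ A (n : ℂ)⁻¹) (expansionTerm γ k * γ)

variable (𝓗) in
/-- The solution of `ψ ∘ Y = ψ * γ`. -/
def expansion (γ : WithConv (H →ₗ[ℂ] A)) : WithConv (H →ₗ[ℂ] A) :=
  WithConv.toConv (gradedLift 𝓗 fun n =>
    (∑ k ∈ Finset.range (n + 1), expansionTerm 𝓗 γ k).ofConv ∘ₗ (𝓗 n).subtype)

theorem expansionTerm_succ_of_mem (γ : WithConv (H →ₗ[ℂ] A)) (k : ℕ) {n : ℕ} {x : H}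
    (hx : x ∈ 𝓗 n) :
    expansionTerm 𝓗 γ (k + 1) x = (n : ℂ)⁻¹ • (expansionTerm 𝓗 γ k * γ) x := by
  rw [expansionTerm, gradedMul_of_mem _ _ hx, Algebra.smul_def]

theorem expansionTerm_vanishesBelow (h𝓗 : IsConnectedGradedHopf 𝓗) {γ : WithConv (H →ₗ[ℂ] A)}
    (hγ : γ ∈ g H A) (k : ℕ) : VanishesBelow 𝓗 k (expansionTerm 𝓗 γ k) := by
  induction k with
  | zero => exact fun n hn => absurd hn (Nat.not_lt_zero n)
  | succ k ih =>
    intro n hn x hx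
    rw [expansionTerm_succ_of_mem γ k hx,
      ih.mul h𝓗 (VanishesBelow.one_of_mem_g h𝓗 hγ) n hn x hx, smul_zero]

theorem compY_expansionTerm (h𝓗 : IsConnectedGradedHopf 𝓗) {γ : WithConv (H →ₗ[ℂ] A)}
    (hγ : γ ∈ g H A) (k : ℕ) :
    compY 𝓗 (expansionTerm 𝓗 γ (k + 1)) = expansionTerm 𝓗 γ k * γ := by
  refine conv_ext_of_homogeneous (𝓗 := 𝓗) fun n x hx => ?_
  rw [compY_of_mem _ hx, expansionTerm_succ_of_mem γ k hx]
  -- In degree `0` the default value `0⁻¹ = 0` does no harm: the left side is zero, and the right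
  -- side vanishes because `γ ∈ 𝔤`.
  by_cases h0 : n = 0
  · have := (expansionTerm_vanishesBelow h𝓗 hγ k).mul h𝓗
      (VanishesBelow.one_of_mem_g h𝓗 hγ) n (by omega) x hx
    rw [this, smul_zero, smul_zero]
  · rw [smul_smul, mul_inv_cancel₀ (Nat.cast_ne_zero.2 h0), one_smul]

theorem expansion_apply_of_mem (γ : WithConv (H →ₗ[ℂ] A)) {n : ℕ} {x : H} (hx : x ∈ 𝓗 n) :
    expansion 𝓗 γ x = ∑ k ∈ Finset.range (n + 1), expansionTerm 𝓗 γ k x := by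
  change gradedLift 𝓗 _ x = _
  rw [gradedLift_of_mem 𝓗 _ hx, ← sum_apply]
  rfl

theorem expansion_sub_vanishesBelow (h𝓗 : IsConnectedGradedHopf 𝓗)
    {γ : WithConv (H →ₗ[ℂ] A)} (hγ : γ ∈ g H A) (N : ℕ) :
    VanishesBelow 𝓗 N (expansion 𝓗 γ - ∑ k ∈ Finset.range N, expansionTerm 𝓗 γ k) := by
  intro n hn x hx
  change expansion 𝓗 γ x - (∑ k ∈ Finset.range N, expansionTerm 𝓗 γ k) x = 0
  rw [expansion_apply_of_mem γ hx, sum_apply, sub_eq_zero]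
  refine Finset.sum_subset (fun k hk => ?_) fun k hk hk' => ?_
  · simp only [Finset.mem_range] at hk ⊢
    omega
  · exact expansionTerm_vanishesBelow h𝓗 hγ k n (by simpa using hk') x hx

theorem expansion_mem_G (γ : WithConv (H →ₗ[ℂ] A)) : expansion 𝓗 γ ∈ G H A := by
  change expansion 𝓗 γ 1 = 1
  rw [expansion_apply_of_mem γ (SetLike.GradedOne.one_mem : (1 : H) ∈ 𝓗 0)]
  simp [expansionTerm]

/-- Composition with `Y` shifts the series: it sends term `k + 1` to term `k` convolved with `γ`,
and kills the zeroth term. -/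
theorem compY_expansion (h𝓗 : IsConnectedGradedHopf 𝓗) {γ : WithConv (H →ₗ[ℂ] A)}
    (hγ : γ ∈ g H A) : compY 𝓗 (expansion 𝓗 γ) = expansion 𝓗 γ * γ := by
  refine conv_ext_of_homogeneous (𝓗 := 𝓗) fun n x hx => ?_
  -- Truncation at `n` already suffices in degree `n`, since `γ` raises the vanishing order of the
  -- remainder by one; this matches the `n + 1` terms of `expansion` after the shift.
  have h1 := (expansion_sub_vanishesBelow h𝓗 hγ n).mul h𝓗
    (VanishesBelow.one_of_mem_g h𝓗 hγ) n (by omega) x hx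
  rw [sub_mul, Finset.sum_mul] at h1
  have h2 : (expansion 𝓗 γ * γ) x =
      (∑ k ∈ Finset.range n, expansionTerm 𝓗 γ k * γ) x := sub_eq_zero.1 h1
  have h3 : ((n : ℂ) • expansionTerm 𝓗 γ 0 x) = 0 := by
    rw [← compY_of_mem _ hx]
    by_cases h0 : n = 0
    · rw [compY_of_mem _ hx, h0, Nat.cast_zero, zero_smul]
    · rw [compY_of_mem _ hx, expansionTerm, LinearMap.convOne_apply,
        counit_eq_zero_of_mem h𝓗 h0 hx, map_zero, smul_zero]
  rw [h2, sum_apply, compY_of_mem _ hx, expansion_apply_of_mem γ hx, Finset.sum_range_succ',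
    smul_add, h3, add_zero, Finset.smul_sum]
  refine Finset.sum_congr rfl fun k _ => ?_
  rw [← compY_of_mem _ hx, compY_expansionTerm h𝓗 hγ]

theorem renormMap_expansion (h𝓗 : IsConnectedGradedHopf 𝓗) {γ : WithConv (H →ₗ[ℂ] A)}
    (hγ : γ ∈ g H A) : renormMap 𝓗 (expansion 𝓗 γ) = γ :=
  ((mem_g_and_compY_eq_iff h𝓗 (expansion_mem_G γ) γ).1 ⟨hγ, compY_expansion h𝓗 hγ⟩).symm

/-- Every term beyond `e` is built from `γ` by convolution products and rational rescaling in each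
degree, so it stays in the non-unital `B`. -/
theorem expansion_sub_one_mem {γ : WithConv (H →ₗ[ℂ] A)} {B : NonUnitalSubalgebra ℂ A}
    (hB : ∀ x, γ x ∈ B) (x : H) : (expansion 𝓗 γ - 1 : WithConv (H →ₗ[ℂ] A)) x ∈ B := by
  have hterm : ∀ k x, expansionTerm 𝓗 γ (k + 1) x ∈ B := by
    intro k
    refine forall_mem_of_homogeneous (𝓗 := 𝓗) (S := B.toSubmodule) fun n x hx => ?_
    rw [expansionTerm_succ_of_mem γ k hx]
    refine B.toSubmodule.smul_mem _ ?_
    induction k generalizing n x with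
    | zero => rw [expansionTerm, one_mul]; exact hB x
    | succ k ih =>
      refine convMul_mem (S := B.toSubmodule) (T := B.toSubmodule)
        (fun s hs t ht => B.mul_mem hs ht) ?_ hB x
      refine forall_mem_of_homogeneous (𝓗 := 𝓗) fun n x hx => ?_
      rw [expansionTerm_succ_of_mem γ k hx]
      exact B.toSubmodule.smul_mem _ (ih n x hx)
  refine forall_mem_of_homogeneous (𝓗 := 𝓗) (S := B.toSubmodule) (fun n x hx => ?_) x
  change expansion 𝓗 γ x - (1 : WithConv (H →ₗ[ℂ] A)) x ∈ B
  rw [expansion_apply_of_mem γ hx, Finset.sum_range_succ', expansionTerm, add_sub_cancel_right]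
  exact sum_mem fun k _ => hterm k x

theorem expansion_mem_G₂ {γ : WithConv (H →ₗ[ℂ] A)} (hγ : γ ∈ g₂ H A) :
    expansion 𝓗 γ ∈ G₂ H A := by
  have hterm : ∀ k x y, expansionTerm 𝓗 γ k (x * y) = expansionTerm 𝓗 γ k (y * x) := by
    intro k
    induction k with
    | zero => exact convOne_comm_apply
    | succ k ih =>
      refine comm_apply_of_homogeneous (𝓗 := 𝓗) fun p q x hx y hy => ?_
      rw [expansionTerm_succ_of_mem γ k (mul_mem_degree hx hy),
        expansionTerm_succ_of_mem γ k (mul_mem_degree' hx hy), convMul_comm_apply ih hγ.2]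
  refine ⟨expansion_mem_G γ, comm_apply_of_homogeneous (𝓗 := 𝓗) fun p q x hx y hy => ?_⟩
  rw [expansion_apply_of_mem γ (mul_mem_degree hx hy),
    expansion_apply_of_mem γ (mul_mem_degree' hx hy)]
  exact Finset.sum_congr rfl fun k _ => hterm k x y

/-- The defect `E(x, y) = φ(xy) - φ(x)φ(y)` satisfies `E(Yx, y) + E(x, Yy) = (E(·, y) * γ)(x) +
(E(x, ·) * γ)(y)`. For homogeneous arguments the left side is the total degree times `E(x, y)`,
while the right side involves `E` only in smaller total degree, so induction gives `E = 0`. -/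
theorem mem_G₁_of_compY_eq_mul (h𝓗 : IsConnectedGradedHopf 𝓗) {φ γ : WithConv (H →ₗ[ℂ] A)}
    (hφ : φ ∈ G H A) (hγ : γ ∈ g H A) (hγ₁ : γ ∈ g₁ H A) (h : compY 𝓗 φ = φ * γ) :
    φ ∈ G₁ H A := by
  have hφ1 : φ.ofConv 1 = 1 := hφ
  let E : H →ₗ[ℂ] H →ₗ[ℂ] A := (LinearMap.mul ℂ H).compr₂ φ.ofConv -
    (LinearMap.mul ℂ A).compl₁₂ φ.ofConv φ.ofConv
  have hE : ∀ x y, E x y = φ (x * y) - φ x * φ y := fun x y => by simp [E]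
  have hYE : ∀ x y, E (Y 𝓗 x) y + E x (Y 𝓗 y) =
      (WithConv.toConv (E.flip y) * γ : WithConv (H →ₗ[ℂ] A)) x +
      (WithConv.toConv (E x) * γ : WithConv (H →ₗ[ℂ] A)) y := by
    intro x y
    have e1 : WithConv.toConv (E.flip y) =
        WithConv.toConv (φ.ofConv ∘ₗ LinearMap.mulRight ℂ y) - mulBy (φ y) φ := by
      ext u
      change E u y = φ (u * y) - φ y * φ u
      rw [hE, mul_comm (φ u)]
    have e2 : WithConv.toConv (E x) =
        WithConv.toConv (φ.ofConv ∘ₗ LinearMap.mulLeft ℂ x) - mulBy (φ x) φ := by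
      ext u
      exact hE x u
    have h1 := convMul_apply_mul_of_mem_g₁ φ hγ₁ x y
    rw [← h] at h1
    change φ.ofConv (Y 𝓗 (x * y)) = _ at h1
    rw [Y_mul, map_add] at h1
    rw [e1, e2, sub_mul, sub_mul, mulBy_convMul, mulBy_convMul, ← h, hE, hE]
    change _ = ((WithConv.toConv (φ.ofConv ∘ₗ LinearMap.mulRight ℂ y) * γ :
        WithConv (H →ₗ[ℂ] A)) x - φ y * φ (Y 𝓗 x)) +
      ((WithConv.toConv (φ.ofConv ∘ₗ LinearMap.mulLeft ℂ x) * γ :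
        WithConv (H →ₗ[ℂ] A)) y - φ x * φ (Y 𝓗 y))
    linear_combination h1
  have hdeg : ∀ n, ∀ p q, p + q = n → ∀ x ∈ 𝓗 p, ∀ y ∈ 𝓗 q, E x y = 0 := by
    intro n
    induction n using Nat.strong_induction_on with
    | _ n ih =>
      intro p q hpq x hx y hy
      -- In total degree `0` connectedness reduces to `E 1 1 = 0`; otherwise the factor `p + q` is
      -- invertible.
      by_cases h0 : n = 0
      · obtain rfl : p = 0 := by omega
        obtain rfl : q = 0 := by omega
        obtain ⟨c, rfl⟩ := exists_eq_smul_one h𝓗 hx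
        obtain ⟨d, rfl⟩ := exists_eq_smul_one h𝓗 hy
        have : E 1 1 = 0 := by rw [hE, mul_one, hφ1, mul_one, sub_self]
        simp [this]
      · have hγv := VanishesBelow.one_of_mem_g h𝓗 hγ
        have v1 : VanishesBelow 𝓗 p (WithConv.toConv (E.flip y)) :=
          fun m hm u hu => ih (m + q) (by omega) m q rfl u hu y hy
        have v2 : VanishesBelow 𝓗 q (WithConv.toConv (E x)) :=
          fun m hm u hu => ih (p + m) (by omega) p m rfl x hx u hu
        have h1 := hYE x y
        rw [v1.mul h𝓗 hγv p (by omega) x hx, v2.mul h𝓗 hγv q (by omega) y hy, Y_of_mem 𝓗 hx,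
          Y_of_mem 𝓗 hy, map_smul, LinearMap.smul_apply, map_smul, ← add_smul, add_zero,
          ← Nat.cast_add, hpq] at h1
        exact (smul_eq_zero.1 h1).resolve_left (Nat.cast_ne_zero.2 h0)
  refine ⟨hφ, fun x y => ?_⟩
  have := bilin_eq_zero_of_homogeneous (𝓗 := 𝓗) (fun p q => hdeg (p + q) p q rfl) x y
  rw [hE] at this
  exact sub_eq_zero.1 this

end Convolution

/-! ### Polar-valued maps and the characterization of `G^Φ₋` -/

section Convolution

variable {H A : Type*} [Ring H] [HopfAlgebra ℂ H] [CommRing A] [Algebra ℂ A]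

theorem conv_ext {φ ψ : WithConv (H →ₗ[ℂ] A)} (h : ∀ x, φ x = ψ x) : φ = ψ :=
  WithConv.ext (LinearMap.ext h)

theorem convMul_eq_sub_one_mul_add (φ ψ : WithConv (H →ₗ[ℂ] A)) : φ * ψ = (φ - 1) * ψ + ψ := by
  rw [sub_mul, one_mul, sub_add_cancel]

theorem convMul_sub_one (φ ψ : WithConv (H →ₗ[ℂ] A)) :
    φ * ψ - 1 = (φ - 1) * (ψ - 1) + ((φ - 1) + (ψ - 1)) := by
  rw [sub_mul, one_mul, mul_sub, mul_one]
  abel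

end Convolution

section Birkhoff

variable {H : Type*} [Ring H] [HopfAlgebra ℂ H] {𝓗 : ℕ → Submodule ℂ H} [GradedAlgebra 𝓗]

/-- `φ - e` is `φ` composed with the projection `x ↦ x - ε(x) 1` onto `Ker ε`. Subtracting `e` gives
a condition on all of `H`, compatible with convolution even though `𝒜₋` has no unit. -/
theorem forall_sub_one_mem_iff {φ : WithConv (H →ₗ[ℂ] Mero)} (hφ : φ ∈ G H Mero) :
    (∀ x, (φ - 1 : WithConv (H →ₗ[ℂ] Mero)) x ∈ polarGerms) ↔
      ∀ x, Coalgebra.counit (R := ℂ) x = 0 → φ x ∈ polarGerms := by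
  have hG : φ.ofConv 1 = 1 := hφ
  have h : ∀ x, (φ - 1 : WithConv (H →ₗ[ℂ] Mero)) x =
      φ (x - Coalgebra.counit (R := ℂ) x • (1 : H)) := by
    intro x
    change φ x - (1 : WithConv (H →ₗ[ℂ] Mero)) x = _
    rw [map_sub, map_smul, hG, LinearMap.convOne_apply, Algebra.algebraMap_eq_smul_one]
  constructor
  · intro hp x hx
    have := hp x
    rwa [h, hx, zero_smul, sub_zero] at this
  · intro hp x
    rw [h]
    exact hp _ (by simp)

theorem polarGerms_mul_mem : ∀ s ∈ polarGerms.toSubmodule, ∀ t ∈ polarGerms.toSubmodule,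
    s * t ∈ polarGerms.toSubmodule := fun _ hs _ ht => polarGerms.mul_mem hs ht

theorem holoGerms_mul_mem : ∀ s ∈ holoGerms.toSubmodule, ∀ t ∈ holoGerms.toSubmodule,
    s * t ∈ holoGerms.toSubmodule := fun _ hs _ ht => holoGerms.mul_mem hs ht

/-- Makes `ψ ∘ Y` polar on all of `H`, and not just on `Ker ε`, when `ψ` is polar on `Ker ε`. -/
theorem counit_Y (h𝓗 : IsConnectedGradedHopf 𝓗) (x : H) :
    Coalgebra.counit (R := ℂ) (Y 𝓗 x) = 0 := by
  have h : compY 𝓗 (1 : WithConv (H →ₗ[ℂ] ℂ)) = 0 := by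
    refine conv_ext_of_homogeneous (𝓗 := 𝓗) fun n x hx => ?_
    rw [compY_of_mem _ hx]
    by_cases h0 : n = 0
    · simp [h0]
    · simp [counit_eq_zero_of_mem h𝓗 h0 hx]
  have h2 : (compY 𝓗 (1 : WithConv (H →ₗ[ℂ] ℂ))).ofConv x = 0 := by rw [h]; simp
  simpa [compY] using h2

theorem renormMap_mem_polarGerms (h𝓗 : IsConnectedGradedHopf 𝓗)
    {ψ : WithConv (H →ₗ[ℂ] Mero)} (hψ : ψ ∈ G H Mero)
    (hp : ∀ x, Coalgebra.counit (R := ℂ) x = 0 → ψ x ∈ polarGerms) (x : H) :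
    renormMap 𝓗 ψ x ∈ polarGerms := by
  have hY : ∀ x, compY 𝓗 ψ x ∈ polarGerms.toSubmodule := fun x => hp _ (counit_Y h𝓗 x)
  have hinv := inverse_sub_one_mem h𝓗 hψ ((forall_sub_one_mem_iff hψ).2 hp)
  rw [renormMap, convMul_eq_sub_one_mul_add]
  exact add_mem (convMul_mem polarGerms_mul_mem hinv hY x) (hY x)

theorem twist_eq_gradedMul (t : ℂ) (ψ : WithConv (H →ₗ[ℂ] Mero)) :
    twist 𝓗 t ψ = gradedMul 𝓗 (fun n => expGerm (t * n)) ψ := rfl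

theorem expGerm_zero : expGerm 0 = 1 := by
  apply Subtype.ext
  refine Germ.coe_eq.2 (Eventually.of_forall fun z => ?_)
  simp

theorem twist_zero (ψ : WithConv (H →ₗ[ℂ] Mero)) : twist 𝓗 0 ψ = ψ :=
  conv_ext_of_homogeneous (𝓗 := 𝓗) fun n x hx => by
    rw [twist_of_mem 𝓗 _ _ hx, zero_mul, expGerm_zero, one_mul]

theorem gradedMul_pow_succ (ψ : WithConv (H →ₗ[ℂ] Mero)) (k : ℕ) :
    gradedMul 𝓗 (fun n => ((n : ℂ) • zGerm) ^ (k + 1)) ψ =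
      mulBy zGerm (compY 𝓗 (gradedMul 𝓗 (fun n => ((n : ℂ) • zGerm) ^ k) ψ)) := by
  refine conv_ext_of_homogeneous (𝓗 := 𝓗) fun n x hx => ?_
  rw [mulBy_apply, compY_of_mem _ hx, gradedMul_of_mem _ _ hx, gradedMul_of_mem _ _ hx,
    pow_succ, Algebra.smul_def, Algebra.smul_def]
  ring

theorem gradedMul_pow_zero (ψ : WithConv (H →ₗ[ℂ] Mero)) :
    gradedMul 𝓗 (fun n => ((n : ℂ) • zGerm) ^ 0) ψ = ψ :=
  conv_ext_of_homogeneous (𝓗 := 𝓗) fun n x hx => by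
    rw [gradedMul_of_mem _ _ hx, pow_zero, one_mul]

/-- With `h_k` the map in the conclusion, `(zY)^k ψ = ψ * h_k`. Applying `zY`, a derivation of
convolution, and using `ψ ∘ Y = ψ * R̃(ψ)` yields `h_{k+1} = z R̃(ψ) * h_k + z (h_k ∘ Y)`, which
preserves holomorphy. -/
theorem inverse_mul_gradedMul_pow_mem (h𝓗 : IsConnectedGradedHopf 𝓗)
    {ψ : WithConv (H →ₗ[ℂ] Mero)} (hψ : ψ ∈ G H Mero)
    (hR : ∀ x, mulBy zGerm (renormMap 𝓗 ψ) x ∈ holoGerms) (k : ℕ) (x : H) :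
    (Ring.inverse ψ * gradedMul 𝓗 (fun n => ((n : ℂ) • zGerm) ^ k) ψ) x ∈ holoGerms := by
  have hu := isUnit_of_mem_G h𝓗 hψ
  have hY := ((mem_g_and_compY_eq_iff h𝓗 hψ _).2 rfl).2
  induction k generalizing x with
  | zero =>
    rw [gradedMul_pow_zero, Ring.inverse_mul_cancel _ hu, LinearMap.convOne_apply]
    exact holoGerms.algebraMap_mem _
  | succ k ih =>
    set h := Ring.inverse ψ * gradedMul 𝓗 (fun n => ((n : ℂ) • zGerm) ^ k) ψ with hh
    have e1 : gradedMul 𝓗 (fun n => ((n : ℂ) • zGerm) ^ k) ψ = ψ * h := by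
      rw [hh, ← mul_assoc, Ring.mul_inverse_cancel _ hu, one_mul]
    have e2 : Ring.inverse ψ * gradedMul 𝓗 (fun n => ((n : ℂ) • zGerm) ^ (k + 1)) ψ =
        mulBy zGerm (renormMap 𝓗 ψ) * h + mulBy zGerm (compY 𝓗 h) := by
      rw [gradedMul_pow_succ, e1, compY_mul h𝓗, hY, convMul_mulBy, mul_add, mul_assoc ψ,
        ← mul_assoc _ ψ, ← mul_assoc _ ψ, Ring.inverse_mul_cancel _ hu, one_mul, one_mul,
        mulBy_add, mulBy_convMul]
    rw [e2]
    exact add_mem (convMul_mem holoGerms_mul_mem hR ih x)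
      (holoGerms.mul_mem zGerm_mem_holoGerms (ih _))

/-- The coefficient of `t` in `ψ^{*-1} * ψ^t` is `z R̃(ψ)`, which gives one direction; the recursion
for the higher coefficients gives the other. -/
theorem inverse_mul_twist_mem_iff (h𝓗 : IsConnectedGradedHopf 𝓗)
    {ψ : WithConv (H →ₗ[ℂ] Mero)} (hψ : ψ ∈ G H Mero) :
    (∀ t x, (Ring.inverse ψ * twist 𝓗 t ψ) x ∈ holoGerms) ↔
      ∀ x, mulBy zGerm (renormMap 𝓗 ψ) x ∈ holoGerms := by
  constructor
  · intro h x
    obtain ⟨a, ha⟩ := exists_convMul_gradedMul_eq_sum (𝓗 := 𝓗) (Ring.inverse ψ) ψ x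
    have h1 := (sum_expGerm_mem_iff a).1 (fun t => by rw [← ha]; exact h t x) 1
    rwa [← ha, gradedMul_pow_succ, gradedMul_pow_zero, convMul_mulBy] at h1
  · intro h t x
    obtain ⟨a, ha⟩ := exists_convMul_gradedMul_eq_sum (𝓗 := 𝓗) (Ring.inverse ψ) ψ x
    rw [twist_eq_gradedMul, ha]
    refine (sum_expGerm_mem_iff a).2 (fun k => ?_) t
    rw [← ha]
    exact inverse_mul_gradedMul_pow_mem h𝓗 hψ h k x

/-- For polar `ψ` the constant factor `(ψ^t)₋` can only be `ψ^{*-1}`, so the condition on `ψ^t`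
becomes holomorphy of `ψ^{*-1} * ψ^t`. -/
theorem mem_GΦminus_iff (h𝓗 : IsConnectedGradedHopf 𝓗) {ψ : WithConv (H →ₗ[ℂ] Mero)} :
    ψ ∈ GΦminus 𝓗 ↔ ψ ∈ G H Mero ∧
      (∀ x, Coalgebra.counit (R := ℂ) x = 0 → ψ x ∈ polarGerms) ∧
      ∀ x, mulBy zGerm (renormMap 𝓗 ψ) x ∈ holoGerms := by
  constructor
  · rintro ⟨⟨hψ, m, hm⟩, hp⟩
    refine ⟨hψ, hp, (inverse_mul_twist_mem_iff h𝓗 hψ).1 ?_⟩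
    obtain ⟨p₀, h₀⟩ := hm 0
    have hmG : m ∈ G H Mero := h₀.minus_one
    have hmu := isUnit_of_mem_G h𝓗 hmG
    have hmul : ∀ t p, IsBirkhoff (twist 𝓗 t ψ) m p → m * twist 𝓗 t ψ = p := by
      intro t p h
      rw [h.eq, ← mul_assoc, Ring.mul_inverse_cancel _ hmu, one_mul]
    have hm1 := (forall_sub_one_mem_iff hmG).2 h₀.minus_mem
    have hψ1 := (forall_sub_one_mem_iff hψ).2 hp
    -- At `t = 0` the product `m * ψ` is the holomorphic factor, while `m * ψ - e` is polar because
    -- `m - e` and `ψ - e` are.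
    have hmψ : m * ψ = 1 := by
      refine sub_eq_zero.1 (conv_ext fun x => ?_)
      refine eq_zero_of_mem_polarGerms_of_mem_holoGerms ?_ ?_
      · rw [convMul_sub_one]
        exact add_mem (convMul_mem polarGerms_mul_mem hm1 hψ1 x) (add_mem (hm1 x) (hψ1 x))
      · have h1 := hmul 0 p₀ h₀
        rw [twist_zero] at h1
        rw [h1]
        exact sub_mem (h₀.plus_mem x) (holoGerms.algebraMap_mem _)
    have hmi : Ring.inverse ψ = m := by
      have := congrArg (· * Ring.inverse ψ) hmψ
      simpa only [mul_assoc, Ring.mul_inverse_cancel _ (isUnit_of_mem_G h𝓗 hψ), mul_one,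
        one_mul] using this.symm
    intro t x
    obtain ⟨p, h⟩ := hm t
    rw [hmi, hmul t p h]
    exact h.plus_mem x
  · rintro ⟨hψ, hp, hR⟩
    have hiG := inverse_mem_G h𝓗 hψ
    refine ⟨⟨hψ, Ring.inverse ψ, fun t => ⟨Ring.inverse ψ * twist 𝓗 t ψ, ?_, hiG, ?_, ?_⟩⟩, hp⟩
    · rw [← mul_assoc, Ring.inverse_mul_cancel _ (isUnit_of_mem_G h𝓗 hiG), one_mul]
    · exact (forall_sub_one_mem_iff hiG).1
        (inverse_sub_one_mem h𝓗 hψ ((forall_sub_one_mem_iff hψ).2 hp))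
    · exact (inverse_mul_twist_mem_iff h𝓗 hψ).2 hR t

theorem algebraMap_mero_injective : Function.Injective (algebraMap ℂ Mero) := by
  have : Nontrivial Mero := ⟨0, 1, fun h => by
    have h1 : (0 : Germ (𝓝[≠] (0 : ℂ)) ℂ) = 1 := congrArg Subtype.val h
    exact zero_ne_one h1⟩
  exact (algebraMap ℂ Mero).injective

/-- `R̃(ψ)` is polar and `z R̃(ψ)` is holomorphic, so `R̃(ψ)(x) = c / z`. The residue of `ψ ∘ Y =
R̃(ψ) + z⁻¹ ((ψ - e) * z R̃(ψ))` at `x` is `c`, because the last convolution is polar times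
constant, hence polar, before the division by `z`. -/
theorem renormMap_eq_of_mem_GΦminus (h𝓗 : IsConnectedGradedHopf 𝓗)
    {ψ : WithConv (H →ₗ[ℂ] Mero)} (h : ψ ∈ GΦminus 𝓗) (x : H) :
    renormMap 𝓗 ψ x = zInvGerm * algebraMap ℂ Mero (Res ψ (Y 𝓗 x)) := by
  obtain ⟨hψ, hp, hR⟩ := (mem_GΦminus_iff h𝓗).1 h
  have hc : ∀ x, ∃ c : ℂ, mulBy zGerm (renormMap 𝓗 ψ) x = algebraMap ℂ Mero c := fun x =>
    exists_eq_const_of_mem (renormMap_mem_polarGerms h𝓗 hψ hp x) (hR x)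
  obtain ⟨c, hcx⟩ := hc x
  have hRx : renormMap 𝓗 ψ x = zInvGerm * algebraMap ℂ Mero c := by
    rw [← hcx, mulBy_apply, zInvGerm_mul_cancel_left]
  have hRz : renormMap 𝓗 ψ = mulBy zInvGerm (mulBy zGerm (renormMap 𝓗 ψ)) :=
    conv_ext fun y => (zInvGerm_mul_cancel_left _).symm
  have hY := ((mem_g_and_compY_eq_iff h𝓗 hψ _).2 rfl).2
  have e : compY 𝓗 ψ = renormMap 𝓗 ψ +
      mulBy zInvGerm ((ψ - 1) * mulBy zGerm (renormMap 𝓗 ψ)) := by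
    rw [← convMul_mulBy, ← hRz, sub_mul, one_mul, add_sub_cancel, hY]
  have hpol : ((ψ - 1) * mulBy zGerm (renormMap 𝓗 ψ)) x ∈ polarGerms := by
    refine convMul_mem (S := polarGerms.toSubmodule) (U := polarGerms.toSubmodule)
      (T := LinearMap.range (Algebra.linearMap ℂ Mero)) ?_ ((forall_sub_one_mem_iff hψ).2 hp)
      (fun y => ?_) x
    · rintro s hs _ ⟨d, rfl⟩
      rw [Algebra.linearMap_apply, mul_comm, ← Algebra.smul_def]
      exact polarGerms.toSubmodule.smul_mem d hs
    · obtain ⟨d, hd⟩ := hc y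
      exact ⟨d, hd.symm⟩
  have hres : Res ψ (Y 𝓗 x) = c := by
    have h1 : ψ (Y 𝓗 x) = renormMap 𝓗 ψ x +
        zInvGerm * ((ψ - 1) * mulBy zGerm (renormMap 𝓗 ψ)) x :=
      congrArg (fun φ : WithConv (H →ₗ[ℂ] Mero) => φ x) e
    rw [Res, h1, hRx]
    exact residue_add_zInvGerm_mul c hpol
  rw [hres, hRx]

/-! ### The map `ψ ↦ z R̃(ψ)` and its inverse -/

theorem mulBy_renormMap_mem_g (h𝓗 : IsConnectedGradedHopf 𝓗) {ψ : WithConv (H →ₗ[ℂ] Mero)}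
    (hψ : ψ ∈ G H Mero) : mulBy zGerm (renormMap 𝓗 ψ) ∈ g H Mero := by
  have h : renormMap 𝓗 ψ 1 = 0 := ((mem_g_and_compY_eq_iff h𝓗 hψ _).2 rfl).1
  change zGerm * renormMap 𝓗 ψ 1 = 0
  rw [h, mul_zero]

theorem mulBy_mem_g₁ (f : Mero) {α : WithConv (H →ₗ[ℂ] Mero)} (hα : α ∈ g₁ H Mero) :
    mulBy f α ∈ g₁ H Mero := fun x y => by
  rw [mulBy_apply, mulBy_apply, mulBy_apply, hα x y]
  ring

theorem mulBy_mem_g₂ (f : Mero) {α : WithConv (H →ₗ[ℂ] Mero)} (hα : α ∈ g₂ H Mero) :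
    mulBy f α ∈ g₂ H Mero :=
  ⟨by change f * α 1 = 0; rw [hα.1, mul_zero], fun x y => congrArg (f * ·) (hα.2 x y)⟩

theorem gc_subset_g : gc H Mero ⊆ g H Mero := by
  rintro α ⟨β, hβ, h⟩
  change α 1 = 0
  rw [h, hβ, map_zero]

theorem mulBy_renormMap_mem_gc (h𝓗 : IsConnectedGradedHopf 𝓗) {ψ : WithConv (H →ₗ[ℂ] Mero)}
    (h : ψ ∈ GΦminus 𝓗) : mulBy zGerm (renormMap 𝓗 ψ) ∈ gc H Mero := by
  have hval : ∀ x, mulBy zGerm (renormMap 𝓗 ψ) x = algebraMap ℂ Mero (Res ψ (Y 𝓗 x)) :=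
    fun x => by
      rw [mulBy_apply, renormMap_eq_of_mem_GΦminus h𝓗 h, zGerm_mul_cancel_left]
  -- Linearity of `x ↦ Res ψ (Y x)` is inherited from `z R̃(ψ)`, with which it agrees under the
  -- injection `ℂ → 𝒜`.
  refine ⟨{ toFun := fun x => Res ψ (Y 𝓗 x), map_add' := fun x y => ?_,
            map_smul' := fun c x => ?_ }, ?_, hval⟩
  · apply algebraMap_mero_injective
    rw [map_add (algebraMap ℂ Mero), ← hval, ← hval, ← hval, map_add]
  · apply algebraMap_mero_injective
    rw [RingHom.id_apply, smul_eq_mul, map_mul (algebraMap ℂ Mero), ← hval, ← hval, map_smul,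
      Algebra.smul_def]
  · apply algebraMap_mero_injective
    change algebraMap ℂ Mero (Res ψ (Y 𝓗 1)) = _
    rw [← hval, map_zero]
    exact mulBy_renormMap_mem_g h𝓗 h.1.1

theorem mulBy_renormMap_injOn (h𝓗 : IsConnectedGradedHopf 𝓗) :
    Set.InjOn (fun ψ => mulBy zGerm (renormMap 𝓗 ψ)) (G H Mero) := by
  intro φ hφ ψ hψ h
  refine eq_of_renormMap_eq h𝓗 hφ hψ (conv_ext fun x => ?_)
  have h1 := congrArg (fun α : WithConv (H →ₗ[ℂ] Mero) => zInvGerm * α x) h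
  simpa only [mulBy_apply, zInvGerm_mul_cancel_left] using h1

theorem mulBy_renormMap_expansion (h𝓗 : IsConnectedGradedHopf 𝓗)
    {β : WithConv (H →ₗ[ℂ] Mero)} (hβ : mulBy zInvGerm β ∈ g H Mero) :
    mulBy zGerm (renormMap 𝓗 (expansion 𝓗 (mulBy zInvGerm β))) = β := by
  rw [renormMap_expansion h𝓗 hβ]
  exact conv_ext fun x => zGerm_mul_cancel_left _

theorem mulBy_zInvGerm_mem_g {β : WithConv (H →ₗ[ℂ] Mero)} (hβ : β ∈ gc H Mero) :
    mulBy zInvGerm β ∈ g H Mero := by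
  have h : β 1 = 0 := gc_subset_g hβ
  change zInvGerm * β 1 = 0
  rw [h, mul_zero]

/-- Surjectivity: the solution for `γ = β / z` is polar because `γ` is, and its `z R̃` is the
constant `β`, in particular holomorphic. -/
theorem expansion_mem_GΦminus (h𝓗 : IsConnectedGradedHopf 𝓗) {β : WithConv (H →ₗ[ℂ] Mero)}
    (hβ : β ∈ gc H Mero) : expansion 𝓗 (mulBy zInvGerm β) ∈ GΦminus 𝓗 := by
  have hG := expansion_mem_G (𝓗 := 𝓗) (mulBy zInvGerm β)
  have hgβ := mulBy_zInvGerm_mem_g hβ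
  obtain ⟨b, -, hb⟩ := hβ
  refine (mem_GΦminus_iff h𝓗).2 ⟨hG, ?_, fun x => ?_⟩
  · refine (forall_sub_one_mem_iff hG).1 (expansion_sub_one_mem fun x => ?_)
    rw [mulBy_apply, hb]
    exact zInvGerm_mul_const_mem _
  · rw [mulBy_renormMap_expansion h𝓗 hgβ, hb]
    exact holoGerms.algebraMap_mem _

end Birkhoff

end HopfRenorm

end

open HopfRenorm
theorem mainTheorem2 {H : Type*} [Ring H] [HopfAlgebra ℂ H] (𝓗 : ℕ → Submodule ℂ H)
    [GradedAlgebra 𝓗] (h𝓗 : IsConnectedGradedHopf 𝓗) :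
    Set.MapsTo (fun ψ => mulBy zGerm (renormMap 𝓗 ψ)) (G H Mero) (g H Mero) ∧
    Set.BijOn (fun ψ => mulBy zGerm (renormMap 𝓗 ψ)) (GΦminus 𝓗) (gc H Mero) ∧
    Set.BijOn (fun ψ => mulBy zGerm (renormMap 𝓗 ψ))
      (GΦminus 𝓗 ∩ G₁ H Mero) (gc H Mero ∩ g₁ H Mero) ∧
    Set.BijOn (fun ψ => mulBy zGerm (renormMap 𝓗 ψ))
      (GΦminus 𝓗 ∩ G₂ H Mero) (gc H Mero ∩ g₂ H Mero) ∧
    ∀ ψ ∈ GΦminus 𝓗, ∀ x : H,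
      renormMap 𝓗 ψ x = zInvGerm * algebraMap ℂ Mero (Res ψ (Y 𝓗 x)) := by
  have hinj : Set.InjOn (fun ψ => mulBy zGerm (renormMap 𝓗 ψ)) (GΦminus 𝓗) :=
    (mulBy_renormMap_injOn h𝓗).mono fun ψ h => h.1.1
  have hmaps : Set.MapsTo (fun ψ => mulBy zGerm (renormMap 𝓗 ψ)) (GΦminus 𝓗) (gc H Mero) :=
    fun ψ h => mulBy_renormMap_mem_gc h𝓗 h
  have hexp : ∀ β ∈ gc H Mero,
      mulBy zGerm (renormMap 𝓗 (expansion 𝓗 (mulBy zInvGerm β))) = β :=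
    fun β hβ => mulBy_renormMap_expansion h𝓗 (mulBy_zInvGerm_mem_g hβ)
  refine ⟨fun ψ hψ => mulBy_renormMap_mem_g h𝓗 hψ, ⟨hmaps, hinj, fun β hβ => ?_⟩,
    ⟨fun ψ hψ => ?_, hinj.mono Set.inter_subset_left, fun β hβ => ?_⟩,
    ⟨fun ψ hψ => ?_, hinj.mono Set.inter_subset_left, fun β hβ => ?_⟩,
    fun ψ hψ x => renormMap_eq_of_mem_GΦminus h𝓗 hψ x⟩
  · exact ⟨_, expansion_mem_GΦminus h𝓗 hβ, hexp β hβ⟩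
  · exact ⟨hmaps hψ.1, mulBy_mem_g₁ _ (renormMap_mem_g₁ h𝓗 hψ.2)⟩
  · have hγ := mulBy_zInvGerm_mem_g hβ.1
    exact ⟨_, ⟨expansion_mem_GΦminus h𝓗 hβ.1, mem_G₁_of_compY_eq_mul h𝓗 (expansion_mem_G _) hγ
      (mulBy_mem_g₁ _ hβ.2) (compY_expansion h𝓗 hγ)⟩, hexp β hβ.1⟩
  · exact ⟨hmaps hψ.1, mulBy_mem_g₂ _ (renormMap_mem_g₂ h𝓗 hψ.2)⟩
  · exact ⟨_, ⟨expansion_mem_GΦminus h𝓗 hβ.1, expansion_mem_G₂ (mulBy_mem_g₂ _ hβ.2)⟩,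
      hexp β hβ.1⟩
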